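/- Let $c_0,\gamma,g,W_0>0$, set $H=c_0^2/(\gamma g)$, $\hat\mu_c=c_0/H=\gamma g/c_0$, and assume $\hat\mu>\hat\mu_c$. Put $\chi=\tfrac12\sqrt{\hat\mu^2-c_0^2/H^2}$. For $\omega>0$ consider $$w(z,t)=W_0\,\mathcal H(t-z/c_0)\Big\{e^{-\frac{\hat\mu-c_0/H}{2}\frac{z}{c_0}}\cos[\omega(t-z/c_0)]+e^{z/(2H)}\,\frac{\chi z}{c_0}\int_{z/c_0}^{t}\frac{e^{-\hat\mu\varsigma/2}\cos[\omega(t-\varsigma)]\,I_1\big(\chi\sqrt{\varsigma^2-(z/c_0)^2}\big)}{\sqrt{\varsigma^2-(z/c_0)^2}}\,d\varsigma\Big\},$$ where $\mathcal H$ is the Heaviside unit step function and $I_1$ the modified Bessel function of the first kind of order one. Let $$\sigma=\sqrt{\frac{\hat\mu_c^2-4\omega^2+\sqrt{(\hat\mu_c^2-4\omega^2)^2+16(\hat\mu\omega)^2}}{2}},\qquad \varkappa=\sqrt{\frac{-\hat\mu_c^2+4\omega^2+\sqrt{(\hat\mu_c^2-4\omega^2)^2+16(\hat\mu\omega)^2}}{2}},$$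 $$w_\infty(z,t)=W_0\exp\!\Big[-\frac{\sigma-\hat\mu_c}{2}\,\frac{z}{c_0}\Big]\cos\!\Big[\omega t-\frac{\varkappa}{2c_0}z\Big].$$ Then: 1. For every $\omega>0$, $w$ is the exact Laplace-domain solution of the signaling problem $w_{tt}-c_0^2w_{zz}+\gamma g\,w_z+\hat\mu w_t=0$ ($z,t>0$), $w(0,t)=W_0\mathcal H(t)\cos\omega t$, $w(z,0)=w_t(z,0)=0$. That is, for every $s>0$ the transform $\overline w(z,s)=\int_0^\infty e^{-st}w(z,t)\,dt$ converges absolutely for all $z\ge0$, is $C^2$ in $z>0$ and continuous in $z\ge0$, and satisfies $c_0^2\overline w''-\gamma g\,\overline w'-(s^2+\hat\mu s)\overline w=0$ for $z>0$, $\overline w(0,s)=W_0s/(s^2+\omega^2)$, and $\overline w(z,s)\to0$ as $z\to\infty$. 2. For every $\omega>0$ and every fixed $z\ge0$, $w(z,t)-w_\infty(z,t)\to0$ as $t\to\infty$. 3. $\hat\mu_c<\sigma<\hat\mu$ for every $\omega>0$. 4. For every $\omega>0$, the signal decays in $z$: $w_\infty(z,t)\to0$ as $z\to\infty$ uniformly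 in $t\in\mathbb R$; for each $\varepsilon>0$ and all sufficiently large $z$, $|w(z,t)|<\varepsilon$ for all sufficiently large $t$; and $w(z,t)\to0$ as $z\to\infty$ for each fixed $t$. 5. There are functions $e_1(\omega)=\mathcal O(\omega^{-2})$ and $e_2(\omega)=\mathcal O(\omega^{-4})$ as $\omega\to\infty$ such that, for all $\omega>0$, $z\ge0$ and all $t$, $$w_\infty(z,t)=W_0\exp\!\Big[-\Big(\frac{\hat\mu-\hat\mu_c}{2}+e_1(\omega)\Big)\frac{z}{c_0}\Big]\cos\!\Big[\omega t-\omega\Big(1+\frac{\hat\mu^2-\hat\mu_c^2}{8\omega^2}+e_2(\omega)\Big)\frac{z}{c_0}\Big],$$ so that $w(z,t)$ minus the right-hand side tends to $0$ as $t\to\infty$ for each fixed $\omega>0$, $z\ge0$. 6. The phase velocity $V_{\rm ph}=\omega/\big(\varkappa/(2c_0)\big)$ of $w_\infty$ satisfies $$V_{\rm ph}=c_0\Big[1-\frac{\hat\mu^2-\hat\mu_c^2}{8\omega^2}\Big]+\mathcal O(\omega^{-4})\qquad(\omega\to\infty).$$ -/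

import Mathlib

open Filter Topology Asymptotics Set

noncomputable section

/-- Modified Bessel function of the first kind of integer order `n`,
`I_n(x) = ∑ₖ (x/2)^(2k+n) / (k! (k+n)!)`. -/
def besselI (n : ℕ) (x : ℝ) : ℝ :=
  ∑' k : ℕ, (x / 2) ^ (2 * k + n) / ((Nat.factorial k : ℝ) * (Nat.factorial (k + n) : ℝ))

/-- Heaviside unit step function. -/
def heavisideStep (x : ℝ) : ℝ := if 0 < x then 1 else 0

/-- Scale height of the isothermal atmosphere, `H = c₀² / (γ g)`. -/
def scaleHeight (c₀ γ g : ℝ) : ℝ := c₀ ^ 2 / (γ * g)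

/-- Critical value of the resistance coefficient, `μ_c = c₀ / H` (which equals `γ g / c₀`). -/
def muCrit (c₀ γ g : ℝ) : ℝ := c₀ / scaleHeight c₀ γ g

/-- `χ = ½ √(μ² - c₀² / H²)`. -/
def chiParam (c₀ γ g μ : ℝ) : ℝ :=
  (1 / 2) * Real.sqrt (μ ^ 2 - c₀ ^ 2 / scaleHeight c₀ γ g ^ 2)

/-- The time-domain solution `w(z,t)` of the signaling problem
`w_tt - c₀² w_zz + γ g w_z + μ w_t = 0`, `w(0,t) = W₀ H(t) cos (ω t)`, `w(z,0) = w_t(z,0) = 0`. -/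
def shockSol (c₀ γ g μ W₀ ω z t : ℝ) : ℝ :=
  W₀ * heavisideStep (t - z / c₀) *
    (Real.exp (-((μ - c₀ / scaleHeight c₀ γ g) / 2) * (z / c₀)) * Real.cos (ω * (t - z / c₀))
      + Real.exp (z / (2 * scaleHeight c₀ γ g)) * (chiParam c₀ γ g μ * z / c₀) *
        ∫ τ in (z / c₀)..t,
          Real.exp (-(μ * τ / 2)) * Real.cos (ω * (t - τ)) *
            besselI 1 (chiParam c₀ γ g μ * Real.sqrt (τ ^ 2 - (z / c₀) ^ 2)) /
              Real.sqrt (τ ^ 2 - (z / c₀) ^ 2))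

/-- Laplace transform in time, `w̄(z,s) = ∫₀^∞ e^{-st} w(z,t) dt`. -/
def laplaceT (w : ℝ → ℝ → ℝ) (z s : ℝ) : ℝ :=
  ∫ t in Ioi (0 : ℝ), Real.exp (-(s * t)) * w z t

/-- `w` solves the signaling problem in the Laplace domain: for every `s > 0` the transform
`w̄(·,s)` converges, solves `c₀² w̄'' - γ g w̄' - (s² + μ s) w̄ = 0` on `z > 0` (the zero initial
data being built in), takes the boundary value `W₀ s / (s² + ω²)` continuously at `z = 0`, and
tends to `0` as `z → ∞`. -/
structure SolvesSignalingLaplace (c₀ γ g μ W₀ ω : ℝ) (w : ℝ → ℝ → ℝ) : Prop where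
  integrable : ∀ s > 0, ∀ z ≥ 0, MeasureTheory.IntegrableOn
    (fun t => Real.exp (-(s * t)) * w z t) (Ioi (0 : ℝ))
  contDiffOn : ∀ s > 0, ContDiffOn ℝ 2 (fun z => laplaceT w z s) (Ioi 0)
  continuousOn : ∀ s > 0, ContinuousOn (fun z => laplaceT w z s) (Ici 0)
  ode : ∀ s > 0, ∀ z > 0,
    c₀ ^ 2 * deriv (deriv (fun y => laplaceT w y s)) z
      - γ * g * deriv (fun y => laplaceT w y s) z
      - (s ^ 2 + μ * s) * laplaceT w z s = 0
  boundary : ∀ s > 0, laplaceT w 0 s = W₀ * s / (s ^ 2 + ω ^ 2)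
  decay : ∀ s > 0, Tendsto (fun z => laplaceT w z s) atTop (𝓝 0)

/-- The radical `σ`, as a function of `μ_c`, `μ` and `ω`. -/
def sigmaRad (μc μ ω : ℝ) : ℝ :=
  Real.sqrt ((μc ^ 2 - 4 * ω ^ 2
    + Real.sqrt ((μc ^ 2 - 4 * ω ^ 2) ^ 2 + 16 * (μ * ω) ^ 2)) / 2)

/-- The radical `ϰ`, as a function of `μ_c`, `μ` and `ω`. -/
def kappaRad (μc μ ω : ℝ) : ℝ :=
  Real.sqrt ((-μc ^ 2 + 4 * ω ^ 2
    + Real.sqrt ((μc ^ 2 - 4 * ω ^ 2) ^ 2 + 16 * (μ * ω) ^ 2)) / 2)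

/-- The large-time waveform
`W₀ exp (-((σ - μ_c)/2) z/c₀) cos (ω t - ½ (ϰ/c₀) z)`. -/
def largeTimeWave (c₀ γ g μ W₀ ω z t : ℝ) : ℝ :=
  W₀ * Real.exp (-((sigmaRad (muCrit c₀ γ g) μ ω - muCrit c₀ γ g) / 2) * (z / c₀)) *
    Real.cos (ω * t - (1 / 2) * (kappaRad (muCrit c₀ γ g) μ ω / c₀) * z)

/-- Phase velocity of the large-time waveform: angular frequency `ω` over wave number
`ϰ / (2 c₀)`. -/
def phaseVelocity (c₀ γ g μ ω : ℝ) : ℝ :=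
  ω / (kappaRad (muCrit c₀ γ g) μ ω / (2 * c₀))

end

open MeasureTheory

/-! ### The Bessel–Clifford functions -/

/-! Everything rests on one transform pair, `laplace_signalKernel`: with k the Bessel kernel of
parameter χ, e^{-ap} + a ∫_a^∞ e^{-pτ} k(τ) dτ = e^{-aq}, where q is the root of q² = p² - χ² with
positive real part, valid for χ < Re p. It is proved by varying v = χ²/4: both sides agree at v = 0,
and a first-order linear system in v propagates the equality.

Behind the front t = z/c₀ the solution is, up to a real factor, the real part of e^{iωt} times
`signalResponse`, the left side above with a = z/c₀, p = μ/2 + iω and the integral truncated at t.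
Since μ_c > 0, χ < μ/2 = Re p, so the pair applies. Letting t → ∞ gives the large-time wave, because
q = (σ + iϰ)/2. Taking the Laplace transform in t, with l = s - iω, moves p to l + p = s + μ/2; the
root is then real, and the transform is a single decaying exponential in z, from which the ODE, the
boundary value and the decay are read off.

The remaining claims are algebra of the radicals, based on ϰ² = σ² + 4ω² - μ_c² and σϰ = 2μω: they
give μ_c < σ < μ (hence decay in z) and explicit remainder bounds at high frequency. -/

/-- The Bessel–Clifford function `C_n(x) = ∑ₖ x ^ k / (k! (k+n)!)`. -/
noncomputable def besselClifford (n : ℕ) (x : ℝ) : ℝ :=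
  ∑' k : ℕ, x ^ k / ((Nat.factorial k : ℝ) * (Nat.factorial (k + n) : ℝ))

theorem abs_besselClifford_term_le (n k : ℕ) (x : ℝ) :
    |x ^ k / ((Nat.factorial k : ℝ) * (Nat.factorial (k + n) : ℝ))|
      ≤ |x| ^ k / (Nat.factorial k : ℝ) := by
  have h1 : (0 : ℝ) < Nat.factorial k := by positivity
  have h2 : (1 : ℝ) ≤ Nat.factorial (k + n) := by
    exact_mod_cast Nat.one_le_iff_ne_zero.2 (Nat.factorial_ne_zero _)
  rw [abs_div, abs_pow, abs_of_pos (by positivity : (0 : ℝ) < _ * _)]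
  apply div_le_div_of_nonneg_left (by positivity) h1
  nlinarith

theorem summable_besselClifford (n : ℕ) (x : ℝ) :
    Summable fun k : ℕ => x ^ k / ((Nat.factorial k : ℝ) * (Nat.factorial (k + n) : ℝ)) :=
  .of_norm_bounded (Real.summable_pow_div_factorial |x|) fun k => by
    rw [Real.norm_eq_abs]; exact abs_besselClifford_term_le n k x

/-- Termwise differentiation on |y| < R: the differentiated terms are dominated by R^{k-1}/(k-1)!,
and shifting the index by one turns k!(k+n)! into k!(k+1+n)!. -/
theorem hasDerivAt_besselClifford (n : ℕ) (x : ℝ) :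
    HasDerivAt (besselClifford n) (besselClifford (n + 1) x) x := by
  set R : ℝ := |x| + 1 with hR
  have hxR : x ∈ Ioo (-R) R := by
    constructor <;> [have := neg_abs_le x; have := le_abs_self x] <;> linarith
  -- The truncated exponent at k = 0 is harmless, since the factor k vanishes there.
  set u : ℕ → ℝ := fun k => k * R ^ (k - 1) / Nat.factorial k with hu
  have hshift : ∀ k : ℕ, u (k + 1) = R ^ k / Nat.factorial k := fun k => by
    simp only [hu, Nat.add_sub_cancel, Nat.factorial_succ, Nat.cast_mul]
    have : ((k + 1 : ℕ) : ℝ) ≠ 0 := by positivity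
    have : (Nat.factorial k : ℝ) ≠ 0 := by positivity
    field_simp
  have hus : Summable u := by
    rw [← summable_nat_add_iff 1]
    simp only [hshift]
    exact Real.summable_pow_div_factorial R
  have key := hasDerivAt_tsum_of_isPreconnected (𝕜 := ℝ)
    (g := fun k y => y ^ k / ((Nat.factorial k : ℝ) * (Nat.factorial (k + n) : ℝ)))
    (g' := fun k y => (k * y ^ (k - 1)) / ((Nat.factorial k : ℝ) * (Nat.factorial (k + n) : ℝ)))
    (y₀ := x) (y := x) hus isOpen_Ioo isPreconnected_Ioo
    (fun k y _ => (hasDerivAt_pow k y).div_const _) ?_ hxR (summable_besselClifford n x) hxR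
  · have hterm : ∀ k : ℕ, ((k + 1 : ℕ) * x ^ (k + 1 - 1)) /
          ((Nat.factorial (k + 1) : ℝ) * (Nat.factorial (k + 1 + n) : ℝ))
        = x ^ k / ((Nat.factorial k : ℝ) * (Nat.factorial (k + (n + 1)) : ℝ)) := fun k => by
      rw [Nat.add_sub_cancel, Nat.factorial_succ, show k + 1 + n = k + (n + 1) by ring]
      push_cast
      have : (k + 1 : ℝ) ≠ 0 := by positivity
      field_simp
    have hs : Summable fun k : ℕ =>
        (k * x ^ (k - 1)) / ((Nat.factorial k : ℝ) * (Nat.factorial (k + n) : ℝ)) := by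
      rw [← summable_nat_add_iff 1]
      exact (summable_besselClifford (n + 1) x).congr fun k => (hterm k).symm
    rw [hs.tsum_eq_zero_add, tsum_congr hterm] at key
    simp only [Nat.cast_zero, zero_mul, zero_div, zero_add] at key
    exact key
  · intro k y hy
    have h1 : (0 : ℝ) < Nat.factorial k := by positivity
    have h2 : (1 : ℝ) ≤ Nat.factorial (k + n) := by
      exact_mod_cast Nat.one_le_iff_ne_zero.2 (Nat.factorial_ne_zero _)
    have hyR : |y| ≤ R := abs_le.2 ⟨hy.1.le, hy.2.le⟩
    rw [Real.norm_eq_abs, abs_div, abs_mul, abs_pow, Nat.abs_cast,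
      abs_of_pos (by positivity : (0 : ℝ) < _ * _)]
    have h3 : |y| ^ (k - 1) ≤ R ^ (k - 1) := pow_le_pow_left₀ (abs_nonneg _) hyR _
    have h4 : 0 ≤ R := by positivity
    apply div_le_div₀ (by positivity) (by gcongr) h1
    nlinarith

theorem continuous_besselClifford (n : ℕ) : Continuous (besselClifford n) :=
  continuous_iff_continuousAt.2 fun x => (hasDerivAt_besselClifford n x).continuousAt

/-- Coefficientwise this is k + (n+1) = k+n+1. The case n = 0 stands in for Bessel's equation below.
-/
theorem besselClifford_recurrence (n : ℕ) (x : ℝ) :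
    x * besselClifford (n + 2) x + (n + 1) * besselClifford (n + 1) x = besselClifford n x := by
  have h2 := (summable_besselClifford (n + 2) x).mul_left x
  have h1 := (summable_besselClifford (n + 1) x).mul_left (n + 1 : ℝ)
  have h0 := summable_besselClifford n x
  have h1' := (summable_nat_add_iff 1).2 h1
  have h0' := (summable_nat_add_iff 1).2 h0
  unfold besselClifford
  rw [← tsum_mul_left, ← tsum_mul_left, h1.tsum_eq_zero_add, h0.tsum_eq_zero_add]
  rw [add_left_comm, ← h2.tsum_add h1']
  congr 1
  · simp [Nat.factorial_succ]
    have : (n + 1 : ℝ) ≠ 0 := by positivity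
    field_simp
  · congr 1
    ext k
    rw [show k + (n + 2) = (k + n + 1) + 1 by ring, show k + 1 + (n + 1) = (k + n + 1) + 1 by ring,
      show k + 1 + n = k + n + 1 by ring, Nat.factorial_succ (k + n + 1), Nat.factorial_succ k]
    push_cast
    have : (k + 1 : ℝ) ≠ 0 := by positivity
    have : (k + n + 1 + 1 : ℝ) ≠ 0 := by positivity
    field_simp
    ring

theorem factorial_two_mul_le (k : ℕ) :
    (Nat.factorial (2 * k) : ℝ) ≤ 2 ^ (2 * k) * (Nat.factorial k * Nat.factorial k) := by
  have h := Nat.add_choose_mul_factorial_mul_factorial k k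
  have h2 := Nat.choose_le_two_pow (k + k) k
  rw [two_mul, ← h]
  push_cast
  rw [mul_assoc]
  gcongr
  exact_mod_cast h2

/-- From (2k)! ≤ 4^k (k!)² the series is dominated by that of cosh(2√|x|). The square root in the
exponent matters: x is quadratic in τ in the applications, so the growth in τ is only exponential,
at the rate needed for convergence whenever χ < Re p. -/
theorem abs_besselClifford_le (n : ℕ) (x : ℝ) :
    |besselClifford n x| ≤ Real.exp (2 * √|x|) := by
  have hcosh := Real.hasSum_cosh (2 * √|x|)
  have hle : ∀ k : ℕ, ‖x ^ k / ((Nat.factorial k : ℝ) * (Nat.factorial (k + n) : ℝ))‖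
      ≤ (2 * √|x|) ^ (2 * k) / (Nat.factorial (2 * k) : ℝ) := fun k => by
    have h1 : (0 : ℝ) < Nat.factorial k := by positivity
    have h2 : (Nat.factorial k : ℝ) ≤ Nat.factorial (k + n) := by
      exact_mod_cast Nat.factorial_le (Nat.le_add_right _ _)
    rw [Real.norm_eq_abs, abs_div, abs_pow, abs_of_pos (by positivity : (0 : ℝ) < _ * _),
      mul_pow, pow_mul √|x|, Real.sq_sqrt (abs_nonneg _),
      div_le_div_iff₀ (by positivity) (by positivity)]
    calc |x| ^ k * (Nat.factorial (2 * k) : ℝ)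
        ≤ |x| ^ k * (2 ^ (2 * k) * (Nat.factorial k * Nat.factorial k)) := by
          gcongr; exact factorial_two_mul_le k
      _ ≤ |x| ^ k * (2 ^ (2 * k) * (Nat.factorial k * Nat.factorial (k + n))) := by gcongr
      _ = _ := by ring
  have := tsum_of_norm_bounded hcosh hle
  refine this.trans ?_
  have h0 : 0 ≤ √|x| := Real.sqrt_nonneg _
  have h1 : Real.exp (-(2 * √|x|)) ≤ Real.exp (2 * √|x|) := Real.exp_le_exp.2 (by linarith)
  rw [Real.cosh_eq]
  linarith

/-- I₁(x)/x is an entire function of x², so the kernel extends smoothly across the front τ = a. -/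
theorem besselI_one_eq (x : ℝ) : besselI 1 x = x / 2 * besselClifford 1 (x ^ 2 / 4) := by
  unfold besselI besselClifford
  rw [← tsum_mul_left]
  congr 1
  ext k
  rw [pow_succ, pow_mul, show (x / 2) ^ 2 = x ^ 2 / 4 by ring]
  ring

theorem abs_besselClifford_mul_le (n : ℕ) {β v a τ : ℝ} (hβ : 0 ≤ β) (hv : |v| ≤ β ^ 2 / 4)
    (ha : 0 ≤ a) (hτ : a ≤ τ) :
    |besselClifford n (v * (τ ^ 2 - a ^ 2))| ≤ Real.exp (β * τ) := by
  refine (abs_besselClifford_le _ _).trans (Real.exp_le_exp.2 ?_)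
  have h0 : 0 ≤ τ := ha.trans hτ
  have h1 : 0 ≤ τ ^ 2 - a ^ 2 := by nlinarith
  have : √|v * (τ ^ 2 - a ^ 2)| ≤ β * τ / 2 := by
    apply Real.sqrt_le_iff.2 ⟨by positivity, ?_⟩
    rw [abs_mul, abs_of_nonneg h1]
    calc |v| * (τ ^ 2 - a ^ 2) ≤ β ^ 2 / 4 * τ ^ 2 := by
          apply mul_le_mul hv _ h1 (by positivity)
          nlinarith [sq_nonneg a]
      _ = _ := by ring
  linarith

/-! ### Laplace integrals over a half-line -/

theorem integrableOn_pow_mul_exp_neg (m : ℕ) {a b : ℝ} (ha : 0 ≤ a) (hb : 0 < b) :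
    IntegrableOn (fun τ : ℝ => τ ^ m * Real.exp (-b * τ)) (Ioi a) := by
  have := integrableOn_rpow_mul_exp_neg_mul_rpow (p := 1) (s := m) (b := b)
    (by have : (0 : ℝ) ≤ m := by positivity
        linarith) one_pos hb
  simp only [Real.rpow_natCast, Real.rpow_one] at this
  exact this.mono_set (Ioi_subset_Ioi ha)

theorem norm_cexp_neg_mul (p : ℂ) (τ : ℝ) :
    ‖Complex.exp (-p * τ)‖ = Real.exp (-p.re * τ) := by
  rw [Complex.norm_exp]; simp

theorem norm_cexp_mul_le {p : ℂ} {f C β τ : ℝ} {m : ℕ} (h : |f| ≤ C * τ ^ m * Real.exp (β * τ)) :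
    ‖Complex.exp (-p * τ) * (f : ℂ)‖ ≤ C * (τ ^ m * Real.exp (-(p.re - β) * τ)) := by
  rw [norm_mul, norm_cexp_neg_mul, Complex.norm_real, Real.norm_eq_abs]
  calc _ ≤ Real.exp (-p.re * τ) * (C * τ ^ m * Real.exp (β * τ)) := by gcongr
    _ = C * (τ ^ m * (Real.exp (-p.re * τ) * Real.exp (β * τ))) := by ring
    _ = _ := by rw [← Real.exp_add]; ring_nf

theorem integrableOn_cexp_mul {p : ℂ} {a β C : ℝ} {m : ℕ} {f : ℝ → ℝ} (ha : 0 ≤ a)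
    (hp : β < p.re) (hf : Continuous f)
    (hb : ∀ τ > a, |f τ| ≤ C * τ ^ m * Real.exp (β * τ)) :
    IntegrableOn (fun τ : ℝ => Complex.exp (-p * τ) * (f τ : ℂ)) (Ioi a) := by
  refine Integrable.mono' ((integrableOn_pow_mul_exp_neg m ha (sub_pos.2 hp)).const_mul C) ?_ ?_
  · exact (by fun_prop : Continuous fun τ : ℝ =>
      Complex.exp (-p * τ) * (f τ : ℂ)).aestronglyMeasurable
  · filter_upwards [ae_restrict_mem measurableSet_Ioi] with τ hτ
    exact norm_cexp_mul_le (hb τ hτ)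

theorem tendsto_cexp_mul {p : ℂ} {a β C : ℝ} {m : ℕ} {f : ℝ → ℝ}
    (hp : β < p.re) (hb : ∀ τ > a, |f τ| ≤ C * τ ^ m * Real.exp (β * τ)) :
    Tendsto (fun τ : ℝ => Complex.exp (-p * τ) * (f τ : ℂ)) atTop (𝓝 0) := by
  have hb' : 0 < p.re - β := sub_pos.2 hp
  have h0 : Tendsto (fun τ : ℝ => C * (τ ^ m * Real.exp (-(p.re - β) * τ))) atTop (𝓝 0) := by
    have h := (Real.tendsto_pow_mul_exp_neg_atTop_nhds_zero m).comp
      (tendsto_id.const_mul_atTop hb')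
    have h := (h.const_mul (C / (p.re - β) ^ m))
    rw [mul_zero] at h
    refine h.congr fun τ => ?_
    simp only [Function.comp, id, mul_pow]
    have : (p.re - β) ^ m ≠ 0 := by positivity
    field_simp
  apply squeeze_zero_norm' _ h0
  filter_upwards [eventually_gt_atTop a] with τ hτ
  exact norm_cexp_mul_le (hb τ hτ)

theorem hasDerivAt_integral_cexp_mul {p : ℂ} {a β C C' v₀ : ℝ} {m m' : ℕ} {F F' : ℝ → ℝ → ℝ}
    {s : Set ℝ} (ha : 0 ≤ a) (hp : β < p.re) (hs : IsOpen s) (hv₀ : v₀ ∈ s)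
    (hF : ∀ v, Continuous (F v)) (hF' : ∀ v, Continuous (F' v))
    (hb : ∀ v ∈ s, ∀ τ > a, |F v τ| ≤ C * τ ^ m * Real.exp (β * τ))
    (hb' : ∀ v ∈ s, ∀ τ > a, |F' v τ| ≤ C' * τ ^ m' * Real.exp (β * τ))
    (hd : ∀ v τ, HasDerivAt (fun v => F v τ) (F' v τ) v) :
    HasDerivAt (fun v => ∫ τ in Ioi a, Complex.exp (-p * τ) * (F v τ : ℂ))
      (∫ τ in Ioi a, Complex.exp (-p * τ) * (F' v₀ τ : ℂ)) v₀ := by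
  refine (hasDerivAt_integral_of_dominated_loc_of_deriv_le (𝕜 := ℝ)
    (F := fun v τ => Complex.exp (-p * τ) * (F v τ : ℂ))
    (F' := fun v τ => Complex.exp (-p * τ) * (F' v τ : ℂ))
    (bound := fun τ => C' * (τ ^ m' * Real.exp (-(p.re - β) * τ))) (hs.mem_nhds hv₀)
    (.of_forall fun v => ?_) ?_ ?_ ?_ ?_ ?_).2
  · have := hF v
    exact (by fun_prop : Continuous fun τ : ℝ =>
      Complex.exp (-p * τ) * (F v τ : ℂ)).aestronglyMeasurable
  · exact integrableOn_cexp_mul ha hp (hF v₀) (hb v₀ hv₀)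
  · have := hF' v₀
    exact (by fun_prop : Continuous fun τ : ℝ =>
      Complex.exp (-p * τ) * (F' v₀ τ : ℂ)).aestronglyMeasurable
  · filter_upwards [ae_restrict_mem measurableSet_Ioi] with τ hτ v hv
    exact norm_cexp_mul_le (hb' v hv τ hτ)
  · exact (integrableOn_pow_mul_exp_neg m' ha (sub_pos.2 hp)).const_mul C'
  · exact .of_forall fun τ v _ => ((hd v τ).ofReal_comp).const_mul _

theorem besselClifford_zero_zero : besselClifford 0 0 = 1 := by
  unfold besselClifford
  rw [tsum_eq_single 0 fun k hk => by simp [hk]]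
  simp

theorem hasDerivAt_besselClifford_mul (n : ℕ) (a v τ : ℝ) :
    HasDerivAt (fun τ => besselClifford n (v * (τ ^ 2 - a ^ 2)))
      (besselClifford (n + 1) (v * (τ ^ 2 - a ^ 2)) * (2 * v * τ)) τ := by
  have h : HasDerivAt (fun τ : ℝ => v * (τ ^ 2 - a ^ 2)) (2 * v * τ) τ := by
    refine (((hasDerivAt_pow 2 τ).sub_const (a ^ 2)).const_mul v).congr_deriv ?_
    simp; ring
  exact (hasDerivAt_besselClifford n _).comp τ h

theorem hasDerivAt_besselClifford_mul_param (n : ℕ) (ρ v : ℝ) :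
    HasDerivAt (fun v => besselClifford n (v * ρ)) (besselClifford (n + 1) (v * ρ) * ρ) v :=
  (hasDerivAt_besselClifford n _).comp v (hasDerivAt_mul_const ρ)

/-- The kernel `2 v C₁(v (τ² - a²))`; with `v = χ² / 4` it equals
`χ I₁(χ √(τ² - a²)) / √(τ² - a²)`. -/
noncomputable def signalKernel (v a τ : ℝ) : ℝ := 2 * v * besselClifford 1 (v * (τ ^ 2 - a ^ 2))

theorem continuous_besselClifford_mul (n : ℕ) (a v : ℝ) :
    Continuous fun τ : ℝ => besselClifford n (v * (τ ^ 2 - a ^ 2)) :=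
  (continuous_besselClifford n).comp (by fun_prop)

theorem continuous_signalKernel (v a : ℝ) : Continuous (signalKernel v a) :=
  continuous_const.mul (continuous_besselClifford_mul 1 a v)

theorem abs_signalKernel_le {β v a τ : ℝ} (hβ : 0 ≤ β) (hv : |v| ≤ β ^ 2 / 4)
    (ha : 0 ≤ a) (hτ : a ≤ τ) :
    |signalKernel v a τ| ≤ β ^ 2 / 2 * τ ^ 0 * Real.exp (β * τ) := by
  rw [signalKernel, abs_mul, abs_mul, abs_two, pow_zero, mul_one]
  apply mul_le_mul (by linarith) (abs_besselClifford_mul_le 1 hβ hv ha hτ) (abs_nonneg _)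
    (by positivity)

/-! ### The Laplace transform of the Bessel kernel, by differentiation in the parameter -/

section LaplaceBessel

variable {p : ℂ} {a β v : ℝ}

theorem hasDerivAt_laplace_besselClifford_zero (ha : 0 ≤ a) (hβ : 0 ≤ β) (hp : β < p.re)
    (hv : v ∈ Ioo (-(β ^ 2 / 4)) (β ^ 2 / 4)) :
    HasDerivAt (fun v => ∫ τ in Ioi a,
        Complex.exp (-p * τ) * (besselClifford 0 (v * (τ ^ 2 - a ^ 2)) : ℂ))
      (∫ τ in Ioi a, Complex.exp (-p * τ) *
        ((besselClifford 1 (v * (τ ^ 2 - a ^ 2)) * (τ ^ 2 - a ^ 2) : ℝ) : ℂ)) v := by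
  refine hasDerivAt_integral_cexp_mul (C := 1) (m := 0) (C' := 1) (m' := 2) ha hp isOpen_Ioo hv
    (F := fun v τ => besselClifford 0 (v * (τ ^ 2 - a ^ 2)))
    (F' := fun v τ => besselClifford 1 (v * (τ ^ 2 - a ^ 2)) * (τ ^ 2 - a ^ 2))
    (fun v => continuous_besselClifford_mul 0 a v)
    (fun v => (continuous_besselClifford_mul 1 a v).mul (by fun_prop)) ?_ ?_ ?_
  · intro v hv τ hτ
    simpa using abs_besselClifford_mul_le 0 hβ (abs_le.2 ⟨hv.1.le, hv.2.le⟩) ha hτ.le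
  · intro v hv τ hτ
    have hτ' : a < τ := hτ
    have h := abs_besselClifford_mul_le 1 hβ (abs_le.2 ⟨hv.1.le, hv.2.le⟩) ha hτ'.le
    have h1 : 0 ≤ τ ^ 2 - a ^ 2 := by nlinarith
    rw [abs_mul, abs_of_nonneg h1, one_mul, mul_comm]
    apply mul_le_mul _ h (abs_nonneg _) (by positivity)
    nlinarith [sq_nonneg a]
  · exact fun v τ => hasDerivAt_besselClifford_mul_param 0 _ v

/-- The prefactor 2v is what closes the system: d/dv [2v C₁(vρ)] = 2(C₁ + vρ C₂) = 2 C₀ by the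
recurrence. -/
theorem hasDerivAt_laplace_signalKernel (ha : 0 ≤ a) (hβ : 0 ≤ β) (hp : β < p.re)
    (hv : v ∈ Ioo (-(β ^ 2 / 4)) (β ^ 2 / 4)) :
    HasDerivAt (fun v => ∫ τ in Ioi a, Complex.exp (-p * τ) * (signalKernel v a τ : ℂ))
      (2 * ∫ τ in Ioi a,
        Complex.exp (-p * τ) * (besselClifford 0 (v * (τ ^ 2 - a ^ 2)) : ℂ)) v := by
  have := hasDerivAt_integral_cexp_mul (C := β ^ 2 / 2) (m := 0) (C' := 2) (m' := 0) ha hp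
    isOpen_Ioo hv
    (F := fun v τ => signalKernel v a τ)
    (F' := fun v τ => 2 * besselClifford 0 (v * (τ ^ 2 - a ^ 2)))
    (fun v => continuous_signalKernel v a)
    (fun v => continuous_const.mul (continuous_besselClifford_mul 0 a v)) ?_ ?_ ?_
  · convert this using 1
    rw [← integral_const_mul]
    congr 1
    ext τ
    push_cast
    ring
  · intro v hv τ hτ
    exact abs_signalKernel_le hβ (abs_le.2 ⟨hv.1.le, hv.2.le⟩) ha hτ.le
  · intro v hv τ hτ
    rw [abs_mul, abs_two, pow_zero, mul_one]
    have := abs_besselClifford_mul_le 0 hβ (abs_le.2 ⟨hv.1.le, hv.2.le⟩) ha hτ.le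
    linarith
  · intro v τ
    have h := ((hasDerivAt_id v).const_mul 2).mul
      (hasDerivAt_besselClifford_mul_param 1 (τ ^ 2 - a ^ 2) v)
    refine h.congr_deriv ?_
    rw [← besselClifford_recurrence 0]
    simp
    ring

/-- Two integrations by parts for f(τ) = (τ² - a²) C₁(v(τ² - a²)), which satisfies f'' = 4v f + 2C₀
+ 2a² k with f(a) = 0 and f'(a) = 2a. This expresses the v-derivative of the C₀ transform through
known quantities. -/
theorem laplace_besselClifford_identity (ha : 0 ≤ a) (hβ : 0 ≤ β) (hp : β < p.re)
    (hv : |v| ≤ β ^ 2 / 4) :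
    (p ^ 2 - 4 * v) * (∫ τ in Ioi a, Complex.exp (-p * τ) *
        ((besselClifford 1 (v * (τ ^ 2 - a ^ 2)) * (τ ^ 2 - a ^ 2) : ℝ) : ℂ))
      = 2 * ((∫ τ in Ioi a,
          Complex.exp (-p * τ) * (besselClifford 0 (v * (τ ^ 2 - a ^ 2)) : ℂ))
        + a * (Complex.exp (-p * a)
          + a * ∫ τ in Ioi a, Complex.exp (-p * τ) * (signalKernel v a τ : ℂ))) := by
  set f : ℝ → ℝ := fun τ => besselClifford 1 (v * (τ ^ 2 - a ^ 2)) * (τ ^ 2 - a ^ 2) with hf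
  set f' : ℝ → ℝ := fun τ => 2 * τ * besselClifford 0 (v * (τ ^ 2 - a ^ 2)) with hf'
  set c₀ : ℝ → ℝ := fun τ => besselClifford 0 (v * (τ ^ 2 - a ^ 2)) with hc₀
  have hd : ∀ τ, HasDerivAt f (f' τ) τ := fun τ => by
    have h := (hasDerivAt_besselClifford_mul 1 a v τ).mul ((hasDerivAt_pow 2 τ).sub_const (a ^ 2))
    refine h.congr_deriv ?_
    simp only [hf']
    rw [← besselClifford_recurrence 0]
    simp
    ring
  have hd' : ∀ τ, HasDerivAt f' (2 * c₀ τ + 2 * (a ^ 2 * signalKernel v a τ) + 4 * v * f τ) τ :=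
    fun τ => by
      have h := ((hasDerivAt_id τ).const_mul 2).mul (hasDerivAt_besselClifford_mul 0 a v τ)
      refine h.congr_deriv ?_
      simp [hc₀, hf, signalKernel]
      ring
  have hbf : ∀ τ > a, |f τ| ≤ 1 * τ ^ 2 * Real.exp (β * τ) := fun τ hτ => by
    have hτ' : a < τ := hτ
    have h := abs_besselClifford_mul_le 1 hβ hv ha hτ'.le
    have h1 : 0 ≤ τ ^ 2 - a ^ 2 := by nlinarith
    rw [abs_mul, abs_of_nonneg h1, one_mul, mul_comm]
    apply mul_le_mul _ h (abs_nonneg _) (by positivity)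
    nlinarith [sq_nonneg a]
  have hbf' : ∀ τ > a, |f' τ| ≤ 2 * τ ^ 1 * Real.exp (β * τ) := fun τ hτ => by
    have hτ' : a < τ := hτ
    have h0 : 0 ≤ τ := by linarith
    rw [abs_mul, abs_of_nonneg (by positivity : 0 ≤ 2 * τ), pow_one]
    exact mul_le_mul_of_nonneg_left (abs_besselClifford_mul_le 0 hβ hv ha hτ'.le) (by positivity)
  have hbc : ∀ τ > a, |c₀ τ| ≤ 1 * τ ^ 0 * Real.exp (β * τ) := fun τ hτ => by
    simpa using abs_besselClifford_mul_le 0 hβ hv ha hτ.le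
  have if_ : IntegrableOn (fun τ : ℝ => Complex.exp (-p * τ) * (f τ : ℂ)) (Ioi a) :=
    integrableOn_cexp_mul ha hp
    ((continuous_besselClifford_mul 1 a v).mul (by fun_prop)) hbf
  have ic : IntegrableOn (fun τ : ℝ => Complex.exp (-p * τ) * (c₀ τ : ℂ)) (Ioi a) :=
    integrableOn_cexp_mul ha hp (continuous_besselClifford_mul 0 a v) hbc
  have ik := integrableOn_cexp_mul ha hp (continuous_signalKernel v a)
    fun τ hτ => abs_signalKernel_le hβ hv ha (le_of_lt hτ)
  -- The primitive -e^{-pτ}(p f + f') performs both integrations by parts at once.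
  have hint := integral_Ioi_of_hasDerivAt_of_tendsto' (a := a) (m := 0)
    (f := fun τ : ℝ => -(p * (Complex.exp (-p * τ) * (f τ : ℂ))
      + Complex.exp (-p * τ) * (f' τ : ℂ)))
    (f' := fun τ : ℝ => (p ^ 2 - 4 * v) * (Complex.exp (-p * τ) * (f τ : ℂ))
      - 2 * (Complex.exp (-p * τ) * (c₀ τ : ℂ))
      - 2 * a ^ 2 * (Complex.exp (-p * τ) * (signalKernel v a τ : ℂ)))
    (fun τ _ => ?_) ?_ ?_
  · rw [integral_sub (by exact (if_.const_mul _).sub (ic.const_mul _)) (ik.const_mul _),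
      integral_sub (if_.const_mul _) (ic.const_mul _), integral_const_mul, integral_const_mul,
      integral_const_mul] at hint
    have h1 : f a = 0 := by simp [hf]
    have h2 : f' a = 2 * a := by simp [hf', besselClifford_zero_zero]
    rw [h1, h2] at hint
    push_cast at hint
    linear_combination hint
  · have he : HasDerivAt (fun τ : ℝ => Complex.exp (-p * τ)) (Complex.exp (-p * τ) * -p) τ := by
      have := ((hasDerivAt_id (τ : ℂ)).const_mul (-p)).cexp.comp_ofReal
      simpa using this
    have h := (((he.mul (hd τ).ofReal_comp).const_mul p).add (he.mul (hd' τ).ofReal_comp)).neg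
    refine h.congr_deriv ?_
    push_cast
    ring
  · exact ((if_.const_mul _).sub (ic.const_mul _)).sub (ik.const_mul _)
  · have h := (((tendsto_cexp_mul hp hbf).const_mul p).add (tendsto_cexp_mul hp hbf')).neg
    simpa using h

/-- For `χ < Re p`, with `v = χ² / 4`: the Laplace transform of the Bessel kernel,
`e^{-ap} + a ∫_a^∞ e^{-pτ} χ I₁(χ √(τ² - a²)) / √(τ² - a²) dτ = e^{-a √(p² - χ²)}`. -/
theorem laplace_signalKernel {q : ℂ} {χ : ℝ} (ha : 0 ≤ a) (hχ : 0 ≤ χ) (hp : χ < p.re)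
    (hq : 0 < q.re) (hpq : q ^ 2 = p ^ 2 - χ ^ 2) :
    Complex.exp (-p * a)
        + a * ∫ τ in Ioi a, Complex.exp (-p * τ) * (signalKernel (χ ^ 2 / 4) a τ : ℂ)
      = Complex.exp (-q * a) := by
  -- A rate strictly between χ and Re p makes χ²/4 an interior point of the parameter interval while
  -- keeping all integrals convergent.
  obtain ⟨β, hβχ, hβp⟩ := exists_between hp
  have hβ : 0 < β := hχ.trans_lt hβχ
  have hp0 : 0 < p.re := hβ.trans hβp
  have hpne : p ≠ 0 := fun h => by simp [h] at hp0
  set S := Ioo (-(β ^ 2 / 4)) (β ^ 2 / 4) with hS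
  have hS0 : (0 : ℝ) ∈ S := ⟨by simp; positivity, by positivity⟩
  have hSχ : χ ^ 2 / 4 ∈ S := ⟨by nlinarith [sq_nonneg χ, sq_nonneg β], by nlinarith⟩
  have hSo : IsOpen S := isOpen_Ioo
  have hSc : IsPreconnected S := isPreconnected_Ioo
  set A : ℝ → ℂ := fun v => ∫ τ in Ioi a,
    Complex.exp (-p * τ) * (besselClifford 0 (v * (τ ^ 2 - a ^ 2)) : ℂ) with hA
  set B : ℝ → ℂ := fun v => Complex.exp (-p * a)
    + a * ∫ τ in Ioi a, Complex.exp (-p * τ) * (signalKernel v a τ : ℂ) with hB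
  set r : ℝ → ℂ := fun v => (p ^ 2 - 4 * (v : ℂ)) ^ (2⁻¹ : ℂ) with hr
  -- For real p, p² > β² > 4v; otherwise Im p² = 2 Re p Im p ≠ 0. So the principal root r is
  -- differentiable along all of S.
  have hslit : ∀ v ∈ S, p ^ 2 - 4 * (v : ℂ) ∈ Complex.slitPlane := fun v hv => by
    by_cases him : p.im = 0
    · left
      simp only [sq, Complex.sub_re, Complex.mul_re, him, Complex.ofReal_re, Complex.ofReal_im]
      simp
      nlinarith [hv.2]
    · right
      have : (p ^ 2 - 4 * (v : ℂ)).im = 2 * (p.re * p.im) := by simp [sq]; ring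
      rw [this]
      exact mul_ne_zero two_ne_zero (mul_ne_zero hp0.ne' him)
  have hrsq : ∀ v, r v ^ 2 = p ^ 2 - 4 * v := fun v => by
    simp only [hr]
    exact Complex.cpow_ofNat_inv_pow _ 2
  have hrne : ∀ v ∈ S, r v ≠ 0 := fun v hv h => by
    have := hrsq v
    rw [h] at this
    exact Complex.slitPlane_ne_zero (hslit v hv) (by simpa using this.symm)
  have hr' : ∀ v ∈ S, HasDerivAt r (-2 / r v) v := fun v hv => by
    have hlin : HasDerivAt (fun v : ℂ => p ^ 2 - 4 * v) (-4) (v : ℂ) := by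
      simpa using ((hasDerivAt_id (v : ℂ)).const_mul 4).const_sub (p ^ 2)
    have h := (hlin.cpow_const (c := (2⁻¹ : ℂ)) (hslit v hv)).comp_ofReal
    refine h.congr_deriv ?_
    have hpow : (p ^ 2 - 4 * (v : ℂ)) ^ ((2⁻¹ : ℂ) - 1) = r v / r v ^ 2 := by
      rw [Complex.cpow_sub _ _ (Complex.slitPlane_ne_zero (hslit v hv)), Complex.cpow_one, hrsq v]
    rw [hpow]
    field_simp [hrne v hv]
    norm_num
  have hA' : ∀ v ∈ S, HasDerivAt A (2 * (A v + a * B v) / r v ^ 2) v := fun v hv => by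
    convert hasDerivAt_laplace_besselClifford_zero ha hβ.le hβp hv using 1
    rw [div_eq_iff (pow_ne_zero 2 (hrne v hv)), mul_comm _ (r v ^ 2), hrsq]
    exact (laplace_besselClifford_identity ha hβ.le hβp (abs_le.2 ⟨hv.1.le, hv.2.le⟩)).symm
  have hB' : ∀ v ∈ S, HasDerivAt B (2 * a * A v) v := fun v hv => by
    refine (((hasDerivAt_laplace_signalKernel ha hβ.le hβp hv).const_mul (a : ℂ)).const_add
      (Complex.exp (-p * a))).congr_deriv ?_
    simp only [hA]
    ring
  have hr0 : r 0 = p := by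
    simp only [hr, Complex.ofReal_zero, mul_zero, sub_zero]
    exact Complex.sq_cpow_two_inv hp0
  have hA0 : A 0 = Complex.exp (-p * a) / p := by
    simp only [hA, zero_mul, besselClifford_zero_zero, Complex.ofReal_one, mul_one]
    rw [integral_exp_mul_complex_Ioi (by simpa using hp0), neg_div_neg_eq]
  have hB0 : B 0 = Complex.exp (-p * a) := by simp [hB, signalKernel]
  have he : ∀ v ∈ S, ∀ c : ℂ, HasDerivAt (fun v => Complex.exp (c * r v))
      (Complex.exp (c * r v) * (c * (-2 / r v))) v := fun v hv c => ((hr' v hv).const_mul c).cexp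
  -- The system B' = 2aA, A' = 2(A + aB)/r², r' = -2/r gives (B - rA)' = -(2a/r)(B - rA), with
  -- integrating factor e^{-ar}; the defect vanishes at v = 0.
  have hD : ∀ v ∈ S, B v = r v * A v := fun v hv => by
    have hd : ∀ v ∈ S, HasDerivAt (fun v => (B v - r v * A v) * Complex.exp (-a * r v)) 0 v :=
      fun v hv => by
        refine (((hB' v hv).sub ((hr' v hv).mul (hA' v hv))).mul (he v hv (-a))).congr_deriv ?_
        have := hrne v hv
        simp only [Pi.mul_apply, Pi.sub_apply]
        field_simp
        ring
    have h := hSo.is_const_of_deriv_eq_zero hSc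
      (fun v hv => (hd v hv).differentiableAt.differentiableWithinAt)
      (fun v hv => (hd v hv).deriv) hv hS0
    simp only [hA0, hB0, hr0] at h
    rw [mul_div_cancel₀ _ hpne, sub_self, zero_mul] at h
    exact sub_eq_zero.1 ((mul_eq_zero.1 h).resolve_right (Complex.exp_ne_zero _))
  -- Now B' = 2aB/r, so B e^{ar} is constant, equal to its value 1 at v = 0.
  have hd : ∀ v ∈ S, HasDerivAt (fun v => B v * Complex.exp (a * r v)) 0 v := fun v hv => by
    refine ((hB' v hv).mul (he v hv a)).congr_deriv ?_
    rw [hD v hv]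
    have := hrne v hv
    field_simp
    ring
  have h := hSo.is_const_of_deriv_eq_zero hSc
    (fun v hv => (hd v hv).differentiableAt.differentiableWithinAt)
    (fun v hv => (hd v hv).deriv) hSχ hS0
  have hrq : r (χ ^ 2 / 4) = q := by
    simp only [hr]
    rw [← Complex.sq_cpow_two_inv hq, hpq]
    congr 2
    push_cast
    ring
  simp only [hB0, hr0, hrq] at h
  rw [← Complex.exp_add, show -p * a + a * p = 0 by ring, Complex.exp_zero] at h
  change B (χ ^ 2 / 4) = _
  rw [neg_mul, Complex.exp_neg, mul_comm q]
  exact eq_inv_of_mul_eq_one_left h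

end LaplaceBessel

/-- The complex amplitude `e^{-pa} + a ∫_a^t e^{-pτ} k(τ) dτ` built from the Bessel kernel. -/
noncomputable def signalResponse (p : ℂ) (v a t : ℝ) : ℂ :=
  Complex.exp (-p * a) + a * ∫ τ in a..t, Complex.exp (-p * τ) * (signalKernel v a τ : ℂ)

/-! ### The truncated transform: large-time limit and Laplace transform in time -/

section SignalResponse

variable {p : ℂ} {a χ : ℝ}

theorem continuous_cexp_mul_signalKernel (p : ℂ) (v a : ℝ) :
    Continuous fun τ : ℝ => Complex.exp (-p * τ) * (signalKernel v a τ : ℂ) := by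
  have := continuous_signalKernel v a
  fun_prop

theorem integrableOn_cexp_mul_signalKernel (ha : 0 ≤ a) (hχ : 0 ≤ χ) (hp : χ < p.re) :
    IntegrableOn (fun τ : ℝ => Complex.exp (-p * τ) * (signalKernel (χ ^ 2 / 4) a τ : ℂ))
      (Ioi a) :=
  integrableOn_cexp_mul ha hp (continuous_signalKernel _ _) fun τ hτ =>
    abs_signalKernel_le hχ (abs_of_nonneg (by positivity)).le ha (le_of_lt hτ)

theorem hasDerivAt_signalResponse (p : ℂ) (v a t : ℝ) :
    HasDerivAt (signalResponse p v a)
      (a * (Complex.exp (-p * t) * (signalKernel v a t : ℂ))) t := by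
  have hc := continuous_cexp_mul_signalKernel p v a
  exact ((intervalIntegral.integral_hasDerivAt_right (hc.intervalIntegrable _ _)
    (hc.stronglyMeasurableAtFilter _ _) hc.continuousAt).const_mul _).const_add _

theorem continuous_signalResponse (p : ℂ) (v a : ℝ) : Continuous (signalResponse p v a) :=
  continuous_iff_continuousAt.2 fun t => (hasDerivAt_signalResponse p v a t).continuousAt

theorem signalResponse_self (p : ℂ) (v a : ℝ) : signalResponse p v a a = Complex.exp (-p * a) := by
  simp [signalResponse]

theorem tendsto_signalResponse {q : ℂ} (ha : 0 ≤ a) (hχ : 0 ≤ χ) (hp : χ < p.re)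
    (hq : 0 < q.re) (hpq : q ^ 2 = p ^ 2 - χ ^ 2) :
    Tendsto (signalResponse p (χ ^ 2 / 4) a) atTop (𝓝 (Complex.exp (-q * a))) := by
  rw [← laplace_signalKernel ha hχ hp hq hpq]
  exact ((intervalIntegral_tendsto_integral_Ioi a
    (integrableOn_cexp_mul_signalKernel ha hχ hp) tendsto_id).const_mul _).const_add _

theorem exists_norm_signalResponse_le (ha : 0 ≤ a) (hχ : 0 ≤ χ) (hp : χ < p.re) :
    ∃ C, ∀ t ≥ a, ‖signalResponse p (χ ^ 2 / 4) a t‖ ≤ C := by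
  have hi := integrableOn_cexp_mul_signalKernel ha hχ hp
  refine ⟨‖Complex.exp (-p * a)‖ + ‖(a : ℂ)‖ * ∫ τ in Ioi a,
    ‖Complex.exp (-p * τ) * (signalKernel (χ ^ 2 / 4) a τ : ℂ)‖, fun t ht => ?_⟩
  refine (norm_add_le _ _).trans ?_
  rw [norm_mul]
  gcongr
  rw [intervalIntegral.integral_of_le ht]
  refine (norm_integral_le_integral_norm _).trans ?_
  exact setIntegral_mono_set hi.norm (.of_forall fun _ => norm_nonneg _)
    (Ioc_subset_Ioi_self.eventuallyLE)

theorem integrableOn_cexp_mul_signalResponse {l : ℂ} (hl : 0 < l.re) (ha : 0 ≤ a) (hχ : 0 ≤ χ)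
    (hp : χ < p.re) :
    IntegrableOn (fun t : ℝ => Complex.exp (-l * t) * signalResponse p (χ ^ 2 / 4) a t)
      (Ioi a) := by
  obtain ⟨C, hC⟩ := exists_norm_signalResponse_le ha hχ hp
  have hi := integrableOn_pow_mul_exp_neg 0 ha hl
  refine Integrable.mono' (hi.const_mul C) ?_ ?_
  · have := continuous_signalResponse p (χ ^ 2 / 4) a
    exact (by fun_prop : Continuous fun t : ℝ =>
      Complex.exp (-l * t) * signalResponse p (χ ^ 2 / 4) a t).aestronglyMeasurable
  · filter_upwards [ae_restrict_mem measurableSet_Ioi] with t ht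
    rw [norm_mul, norm_cexp_neg_mul, mul_comm, pow_zero, one_mul]
    exact mul_le_mul_of_nonneg_right (hC t (le_of_lt ht)) (Real.exp_nonneg _)

/-- Integration by parts in t replaces an exchange of integrals: the derivative of the response
carries e^{-pt}, which merges with e^{-lt} into the full kernel transform at l + p. -/
theorem integral_cexp_mul_signalResponse {l q : ℂ} (hl : 0 < l.re) (ha : 0 ≤ a) (hχ : 0 ≤ χ)
    (hp : χ < p.re) (hq : 0 < q.re) (hpq : q ^ 2 = (l + p) ^ 2 - χ ^ 2) :
    ∫ t in Ioi a, Complex.exp (-l * t) * signalResponse p (χ ^ 2 / 4) a t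
      = Complex.exp (-q * a) / l := by
  have hlne : l ≠ 0 := fun h => by simp [h] at hl
  have hlp : χ < (l + p).re := by rw [Complex.add_re]; linarith
  have hik := integrableOn_cexp_mul_signalKernel ha hχ hlp
  have hir := integrableOn_cexp_mul_signalResponse hl ha hχ hp
  have hadd : ∀ t : ℝ, Complex.exp (-(l + p) * t) = Complex.exp (-l * t) * Complex.exp (-p * t) :=
    fun t => by rw [← Complex.exp_add]; ring_nf
  have hint := integral_Ioi_of_hasDerivAt_of_tendsto' (a := a) (m := 0)
    (f := fun t : ℝ => Complex.exp (-l * t) * signalResponse p (χ ^ 2 / 4) a t)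
    (f' := fun t : ℝ =>
      a * (Complex.exp (-(l + p) * t) * (signalKernel (χ ^ 2 / 4) a t : ℂ))
      - l * (Complex.exp (-l * t) * signalResponse p (χ ^ 2 / 4) a t))
    (fun t _ => ?_) ?_ ?_
  · rw [integral_sub (hik.const_mul _) (hir.const_mul _), integral_const_mul,
      integral_const_mul, signalResponse_self, ← hadd] at hint
    rw [eq_div_iff hlne, ← laplace_signalKernel ha hχ hlp hq hpq]
    linear_combination -hint
  · have he : HasDerivAt (fun t : ℝ => Complex.exp (-l * t)) (Complex.exp (-l * t) * -l) t := by
      have := ((hasDerivAt_id (t : ℂ)).const_mul (-l)).cexp.comp_ofReal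
      simpa using this
    refine (he.mul (hasDerivAt_signalResponse p (χ ^ 2 / 4) a t)).congr_deriv ?_
    rw [hadd]
    ring
  · exact (hik.const_mul _).sub (hir.const_mul _)
  · obtain ⟨C, hC⟩ := exists_norm_signalResponse_le ha hχ hp
    have h0 : Tendsto (fun t : ℝ => Complex.exp (-l * t)) atTop (𝓝 0) := by
      simpa using tendsto_cexp_mul (p := l) (f := fun _ => 1) (C := 1) (m := 0) (β := 0) (a := a)
        hl (fun τ _ => by simp)
    refine squeeze_zero_norm' (a := fun t : ℝ => ‖Complex.exp (-l * t)‖ * C) ?_ ?_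
    · filter_upwards [eventually_ge_atTop a] with t ht
      rw [norm_mul]
      gcongr
      exact hC t ht
    · simpa using h0.norm.mul_const C

theorem besselI_kernel_eq {τ : ℝ} (hτ : a ^ 2 < τ ^ 2) :
    χ * (besselI 1 (χ * √(τ ^ 2 - a ^ 2)) / √(τ ^ 2 - a ^ 2)) = signalKernel (χ ^ 2 / 4) a τ := by
  have h : 0 < τ ^ 2 - a ^ 2 := sub_pos.2 hτ
  have hs : √(τ ^ 2 - a ^ 2) ≠ 0 := (Real.sqrt_pos.2 h).ne'
  rw [besselI_one_eq, mul_pow, Real.sq_sqrt h.le, signalKernel,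
    show χ ^ 2 * (τ ^ 2 - a ^ 2) / 4 = χ ^ 2 / 4 * (τ ^ 2 - a ^ 2) by ring]
  field_simp
  ring

theorem re_cexp_mul_signalResponse (μ ω χ : ℝ) {t : ℝ} (ha : 0 ≤ a) (ht : a ≤ t) :
    (Complex.exp (ω * t * Complex.I) *
        signalResponse (μ / 2 + ω * Complex.I) (χ ^ 2 / 4) a t).re
      = Real.exp (-(μ / 2 * a)) * Real.cos (ω * (t - a)) + χ * a *
        ∫ τ in a..t, Real.exp (-(μ * τ / 2)) * Real.cos (ω * (t - τ)) *
          besselI 1 (χ * √(τ ^ 2 - a ^ 2)) / √(τ ^ 2 - a ^ 2) := by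
  have hexp : ∀ τ : ℝ, (Complex.exp (ω * t * Complex.I) *
      Complex.exp (-(μ / 2 + ω * Complex.I) * τ)).re
      = Real.exp (-(μ / 2 * τ)) * Real.cos (ω * (t - τ)) := fun τ => by
    rw [← Complex.exp_add, Complex.exp_re]
    simp
    ring_nf
  have hc := continuous_cexp_mul_signalKernel (μ / 2 + ω * Complex.I) (χ ^ 2 / 4) a
  have hre : (Complex.exp (ω * t * Complex.I) * ∫ τ in a..t,
      Complex.exp (-(μ / 2 + ω * Complex.I) * τ) * (signalKernel (χ ^ 2 / 4) a τ : ℂ)).re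
      = ∫ τ in a..t, Real.exp (-(μ / 2 * τ)) * Real.cos (ω * (t - τ)) *
          signalKernel (χ ^ 2 / 4) a τ := by
    rw [← intervalIntegral.integral_const_mul]
    have h := Complex.reCLM.intervalIntegral_comp_comm
      ((continuous_const.mul hc).intervalIntegrable (μ := volume) a t
        (u := fun τ : ℝ => Complex.exp (ω * t * Complex.I) *
          (Complex.exp (-(μ / 2 + ω * Complex.I) * τ) * (signalKernel (χ ^ 2 / 4) a τ : ℂ))))
    simp only [Complex.reCLM_apply] at h
    rw [← h]
    congr 1
    ext τ
    rw [← mul_assoc, Complex.re_mul_ofReal, hexp]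
  rw [signalResponse, mul_add, Complex.add_re, hexp, mul_left_comm, Complex.re_ofReal_mul, hre,
    mul_comm χ a, mul_assoc a χ, ← intervalIntegral.integral_const_mul χ]
  congr 2
  -- Only a < τ ≤ t is compared; at τ = a the Bessel quotient is 0/0 and would not match the kernel.
  apply intervalIntegral.integral_congr_ae
  refine .of_forall fun τ hτ => ?_
  rw [uIoc_of_le ht] at hτ
  have : a ^ 2 < τ ^ 2 := pow_lt_pow_left₀ hτ.1 ha two_ne_zero
  rw [← besselI_kernel_eq this]
  ring_nf

end SignalResponse

/-! ### The radicals `σ` and `ϰ` -/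

section Radicals

variable {m μ ω : ℝ}

theorem abs_lt_sqrt_radicand (hμ : 0 < μ) (hω : 0 < ω) :
    |m ^ 2 - 4 * ω ^ 2| < √((m ^ 2 - 4 * ω ^ 2) ^ 2 + 16 * (μ * ω) ^ 2) := by
  apply Real.lt_sqrt_of_sq_lt
  rw [sq_abs]
  have : 0 < (μ * ω) ^ 2 := by positivity
  linarith

theorem sq_sqrt_radicand (m μ ω : ℝ) :
    √((m ^ 2 - 4 * ω ^ 2) ^ 2 + 16 * (μ * ω) ^ 2) ^ 2
      = (m ^ 2 - 4 * ω ^ 2) ^ 2 + 16 * (μ * ω) ^ 2 :=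
  Real.sq_sqrt (by positivity)

theorem sigmaRad_sq (hμ : 0 < μ) (hω : 0 < ω) : sigmaRad m μ ω ^ 2 =
    (m ^ 2 - 4 * ω ^ 2 + √((m ^ 2 - 4 * ω ^ 2) ^ 2 + 16 * (μ * ω) ^ 2)) / 2 :=
  Real.sq_sqrt (by linarith [(abs_lt.1 (abs_lt_sqrt_radicand (m := m) hμ hω)).1])

theorem kappaRad_sq (hμ : 0 < μ) (hω : 0 < ω) : kappaRad m μ ω ^ 2 =
    (-m ^ 2 + 4 * ω ^ 2 + √((m ^ 2 - 4 * ω ^ 2) ^ 2 + 16 * (μ * ω) ^ 2)) / 2 :=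
  Real.sq_sqrt (by linarith [(abs_lt.1 (abs_lt_sqrt_radicand (m := m) hμ hω)).2])

theorem kappaRad_sq_eq (hμ : 0 < μ) (hω : 0 < ω) :
    kappaRad m μ ω ^ 2 = sigmaRad m μ ω ^ 2 + 4 * ω ^ 2 - m ^ 2 := by
  rw [sigmaRad_sq hμ hω, kappaRad_sq hμ hω]
  ring

theorem sigmaRad_mul_kappaRad (hμ : 0 < μ) (hω : 0 < ω) :
    sigmaRad m μ ω * kappaRad m μ ω = 2 * (μ * ω) := by
  have h : 0 ≤ sigmaRad m μ ω * kappaRad m μ ω :=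
    mul_nonneg (Real.sqrt_nonneg _) (Real.sqrt_nonneg _)
  refine (sq_eq_sq₀ h (by positivity)).1 ?_
  rw [mul_pow, sigmaRad_sq hμ hω, kappaRad_sq hμ hω]
  linear_combination sq_sqrt_radicand m μ ω / 4

/-- After squaring twice, both bounds reduce to m² < μ²: the differences are 16ω²(μ² - m²) and
4μ²(μ² - m²). -/
theorem sigmaRad_mem_Ioo (hm : 0 < m) (hmμ : m < μ) (hω : 0 < ω) :
    sigmaRad m μ ω ∈ Ioo m μ := by
  have hμ : 0 < μ := hm.trans hmμ
  have hsq : m ^ 2 < μ ^ 2 := pow_lt_pow_left₀ hmμ hm.le two_ne_zero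
  constructor
  · apply Real.lt_sqrt_of_sq_lt
    have : m ^ 2 + 4 * ω ^ 2 < √((m ^ 2 - 4 * ω ^ 2) ^ 2 + 16 * (μ * ω) ^ 2) := by
      apply Real.lt_sqrt_of_sq_lt
      nlinarith [mul_lt_mul_of_pos_right hsq (sq_pos_of_pos hω)]
    linarith
  · rw [sigmaRad, Real.sqrt_lt' hμ]
    have : √((m ^ 2 - 4 * ω ^ 2) ^ 2 + 16 * (μ * ω) ^ 2) < 2 * μ ^ 2 - m ^ 2 + 4 * ω ^ 2 := by
      rw [Real.sqrt_lt' (by nlinarith)]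
      nlinarith [mul_lt_mul_of_pos_right hsq (sq_pos_of_pos hμ)]
    linarith

/-- Eliminating ϰ gives 4ω²(μ² - σ²) = σ²(σ² - m²), whose right side is at most μ²(μ² - m²). -/
theorem sq_sub_sigmaRad_sq_le (hm : 0 < m) (hmμ : m < μ) (hω : 0 < ω) :
    μ ^ 2 - sigmaRad m μ ω ^ 2 ≤ μ ^ 2 * (μ ^ 2 - m ^ 2) / 4 / ω ^ 2 := by
  have hμ : 0 < μ := hm.trans hmμ
  obtain ⟨h1, h2⟩ := sigmaRad_mem_Ioo hm hmμ hω
  have h3 := sigmaRad_mul_kappaRad (m := m) hμ hω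
  have h4 := kappaRad_sq_eq (m := m) hμ hω
  set σ := sigmaRad m μ ω
  have h5 : σ ^ 2 * (σ ^ 2 + 4 * ω ^ 2 - m ^ 2) = 4 * (μ * ω) ^ 2 := by
    rw [← h4, ← mul_pow, h3]; ring
  have h6 : m ^ 2 < σ ^ 2 := pow_lt_pow_left₀ h1 hm.le two_ne_zero
  have h7 : σ ^ 2 < μ ^ 2 := pow_lt_pow_left₀ h2 (hm.trans h1).le two_ne_zero
  rw [div_div, le_div_iff₀ (by positivity)]
  nlinarith [mul_pos (sub_pos.2 h6) (sub_pos.2 h7),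
    mul_pos (sq_pos_of_pos hμ) (sub_pos.2 h7)]

theorem sigmaRad_sub_isBigO (hm : 0 < m) (hmμ : m < μ) :
    (fun ω => (sigmaRad m μ ω - μ) / 2) =O[atTop] fun ω : ℝ => 1 / ω ^ 2 := by
  have hμ : 0 < μ := hm.trans hmμ
  refine .of_bound (μ ^ 2 * (μ ^ 2 - m ^ 2) / 4 / (2 * μ)) ?_
  filter_upwards [eventually_gt_atTop 0] with ω hω
  have h := sq_sub_sigmaRad_sq_le hm hmμ hω
  obtain ⟨h1, h2⟩ := sigmaRad_mem_Ioo hm hmμ hω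
  rw [Real.norm_eq_abs, Real.norm_eq_abs, abs_of_nonpos (by linarith),
    abs_of_pos (by positivity)]
  have h3 : (μ - sigmaRad m μ ω) * μ ≤ μ ^ 2 - sigmaRad m μ ω ^ 2 := by nlinarith
  calc -((sigmaRad m μ ω - μ) / 2) = (μ - sigmaRad m μ ω) * μ / (2 * μ) := by
        field_simp; ring
    _ ≤ μ ^ 2 * (μ ^ 2 - m ^ 2) / 4 / ω ^ 2 / (2 * μ) := by gcongr; exact h3.trans h
    _ = _ := by ring

/-- Second-order expansion of the normalized wave number `ϰ / (2 ω)`. -/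
theorem kappaRad_expansion (hm : 0 < m) (hmμ : m < μ) (hω : 0 < ω) :
    1 ≤ kappaRad m μ ω / (2 * ω) ∧
    |kappaRad m μ ω / (2 * ω) - 1 - (μ ^ 2 - m ^ 2) / (8 * ω ^ 2)|
      ≤ (μ ^ 2 * (μ ^ 2 - m ^ 2) / 32 + (μ ^ 2 - m ^ 2) ^ 2 / 128) * (1 / ω ^ 4) := by
  have hμ : 0 < μ := hm.trans hmμ
  have hK := sq_sub_sigmaRad_sq_le hm hmμ hω
  obtain ⟨h1, h2⟩ := sigmaRad_mem_Ioo hm hmμ hω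
  have h4 := kappaRad_sq_eq (m := m) hμ hω
  have h6 : m ^ 2 < sigmaRad m μ ω ^ 2 := pow_lt_pow_left₀ h1 hm.le two_ne_zero
  have h7 : sigmaRad m μ ω ^ 2 < μ ^ 2 := pow_lt_pow_left₀ h2 (hm.trans h1).le two_ne_zero
  set σ := sigmaRad m μ ω
  set r := kappaRad m μ ω / (2 * ω) with hr
  set y := (σ ^ 2 - m ^ 2) / (4 * ω ^ 2) with hy
  have hy0 : 0 ≤ y := div_nonneg (by linarith) (by positivity)
  have hyD : y ≤ (μ ^ 2 - m ^ 2) / (4 * ω ^ 2) := by rw [hy]; gcongr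
  have hr0 : 0 ≤ r := div_nonneg (Real.sqrt_nonneg _) (by positivity)
  have hr2 : r ^ 2 = 1 + y := by
    rw [hr, hy, div_pow, h4]
    field_simp
    ring
  have hr1 : 1 ≤ r := by nlinarith
  refine ⟨hr1, ?_⟩
  have hry : (r - 1) * 2 ≤ y := by nlinarith
  have hsq : (r - 1) ^ 2 / 2 ≤ (μ ^ 2 - m ^ 2) ^ 2 / 128 * (1 / ω ^ 4) := by
    have h : r - 1 ≤ (μ ^ 2 - m ^ 2) / (4 * ω ^ 2) / 2 := by linarith
    calc (r - 1) ^ 2 / 2 ≤ ((μ ^ 2 - m ^ 2) / (4 * ω ^ 2) / 2) ^ 2 / 2 := by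
          gcongr
      _ = _ := by field_simp; ring
  have hlin : (μ ^ 2 - σ ^ 2) / (8 * ω ^ 2) ≤ μ ^ 2 * (μ ^ 2 - m ^ 2) / 32 * (1 / ω ^ 4) := by
    calc (μ ^ 2 - σ ^ 2) / (8 * ω ^ 2)
        ≤ μ ^ 2 * (μ ^ 2 - m ^ 2) / 4 / ω ^ 2 / (8 * ω ^ 2) := by gcongr
      _ = _ := by field_simp; ring
  have hlin0 : 0 ≤ (μ ^ 2 - σ ^ 2) / (8 * ω ^ 2) := div_nonneg (by linarith) (by positivity)
  -- Exact form of the remainder: r² = 1 + y gives r - 1 = y/2 - (r - 1)²/2, and replacing σ by μ in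
  -- y costs the second term.
  have hsplit : r - 1 - (μ ^ 2 - m ^ 2) / (8 * ω ^ 2)
      = -((r - 1) ^ 2 / 2) - (μ ^ 2 - σ ^ 2) / (8 * ω ^ 2) := by
    have : (μ ^ 2 - m ^ 2) / (8 * ω ^ 2) = y / 2 + (μ ^ 2 - σ ^ 2) / (8 * ω ^ 2) := by
      rw [hy]; field_simp; ring
    rw [this]
    linear_combination hr2 / 2
  rw [hsplit, abs_of_nonpos (by nlinarith [sq_nonneg (r - 1)])]
  linarith

theorem kappaRad_sub_isBigO (hm : 0 < m) (hmμ : m < μ) :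
    (fun ω => kappaRad m μ ω / (2 * ω) - 1 - (μ ^ 2 - m ^ 2) / (8 * ω ^ 2))
      =O[atTop] fun ω : ℝ => 1 / ω ^ 4 := by
  refine .of_bound (μ ^ 2 * (μ ^ 2 - m ^ 2) / 32 + (μ ^ 2 - m ^ 2) ^ 2 / 128) ?_
  filter_upwards [eventually_gt_atTop 0] with ω hω
  rw [Real.norm_eq_abs, Real.norm_of_nonneg (by positivity : 0 ≤ 1 / ω ^ 4)]
  exact (kappaRad_expansion hm hmμ hω).2

theorem inv_kappaRad_isBigO (hm : 0 < m) (hmμ : m < μ) :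
    (fun ω => (kappaRad m μ ω / (2 * ω))⁻¹ - (1 - (μ ^ 2 - m ^ 2) / (8 * ω ^ 2)))
      =O[atTop] fun ω : ℝ => 1 / ω ^ 4 := by
  set D := μ ^ 2 - m ^ 2 with hD
  have hD0 : 0 < D := sub_pos.2 (pow_lt_pow_left₀ hmμ hm.le two_ne_zero)
  set E := μ ^ 2 * D / 32 + D ^ 2 / 128 with hE
  have hE0 : 0 ≤ E := by positivity
  refine .of_bound (D ^ 2 / 64 + D / 8 * E + E) ?_
  -- ω ≥ 1 is used to bound δ by D/8, so that the cross term stays of order ω⁻⁴.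
  filter_upwards [eventually_ge_atTop 1] with ω hω1
  have hω : 0 < ω := by linarith
  obtain ⟨h1, h2⟩ := kappaRad_expansion hm hmμ hω
  rw [← hD, ← hE] at h2
  rw [Real.norm_eq_abs, Real.norm_of_nonneg (by positivity : 0 ≤ 1 / ω ^ 4)]
  set r := kappaRad m μ ω / (2 * ω)
  set δ := D / (8 * ω ^ 2) with hδ
  have hδ0 : 0 ≤ δ := by positivity
  have hδ1 : δ ≤ D / 8 := by
    rw [hδ]
    apply div_le_div_of_nonneg_left hD0.le (by norm_num)
    nlinarith
  have hδ2 : δ ^ 2 = D ^ 2 / 64 * (1 / ω ^ 4) := by rw [hδ]; field_simp; norm_num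
  have hr : 0 < r := by linarith
  have heq : r⁻¹ - (1 - δ) = (δ ^ 2 + δ * (r - 1 - δ) - (r - 1 - δ)) / r := by
    field_simp
    ring
  rw [heq, abs_div, abs_of_pos hr]
  calc |δ ^ 2 + δ * (r - 1 - δ) - (r - 1 - δ)| / r
      ≤ |δ ^ 2 + δ * (r - 1 - δ) - (r - 1 - δ)| := div_le_self (abs_nonneg _) h1
    _ ≤ |δ ^ 2| + |δ * (r - 1 - δ)| + |r - 1 - δ| :=
        (abs_sub _ _).trans (add_le_add_left (abs_add_le _ _) _)
    _ = δ ^ 2 + δ * |r - 1 - δ| + |r - 1 - δ| := by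
        rw [abs_mul, abs_of_nonneg hδ0, abs_of_nonneg (sq_nonneg δ)]
    _ ≤ D ^ 2 / 64 * (1 / ω ^ 4) + D / 8 * (E * (1 / ω ^ 4)) + E * (1 / ω ^ 4) := by
        rw [hδ2]; gcongr
    _ = _ := by ring

end Radicals

/-! ### The signaling problem -/

section Signaling

variable {c₀ γ g μ W₀ ω : ℝ}

theorem muCrit_pos (hc : 0 < c₀) (hγ : 0 < γ) (hg : 0 < g) : 0 < muCrit c₀ γ g := by
  unfold muCrit scaleHeight
  positivity

theorem mul_muCrit (hc : 0 < c₀) (hγ : 0 < γ) (hg : 0 < g) :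
    c₀ * muCrit c₀ γ g = γ * g := by
  unfold muCrit scaleHeight
  field_simp

theorem chiParam_eq (c₀ γ g μ : ℝ) :
    chiParam c₀ γ g μ = 1 / 2 * √(μ ^ 2 - muCrit c₀ γ g ^ 2) := by
  rw [chiParam, muCrit, div_pow]

theorem chiParam_nonneg (c₀ γ g μ : ℝ) : 0 ≤ chiParam c₀ γ g μ := by
  rw [chiParam_eq]; positivity

theorem chiParam_sq (hm : 0 < muCrit c₀ γ g) (hμ : muCrit c₀ γ g < μ) :
    chiParam c₀ γ g μ ^ 2 = (μ ^ 2 - muCrit c₀ γ g ^ 2) / 4 := by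
  rw [chiParam_eq, mul_pow, Real.sq_sqrt (by nlinarith)]
  ring

theorem chiParam_lt (hm : 0 < muCrit c₀ γ g) (hμ : muCrit c₀ γ g < μ) :
    chiParam c₀ γ g μ < μ / 2 := by
  refine lt_of_pow_lt_pow_left₀ 2 (by linarith) ?_
  rw [chiParam_sq hm hμ]
  nlinarith

theorem shockSol_of_le {z t : ℝ} (h : t ≤ z / c₀) : shockSol c₀ γ g μ W₀ ω z t = 0 := by
  rw [shockSol, heavisideStep, if_neg (by linarith)]
  ring

theorem shockSol_of_lt {z t : ℝ} (hc : 0 < c₀) (hγ : 0 < γ) (hg : 0 < g) (hz : 0 ≤ z)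
    (h : z / c₀ < t) :
    shockSol c₀ γ g μ W₀ ω z t = W₀ * Real.exp (muCrit c₀ γ g / 2 * (z / c₀)) *
      (Complex.exp (ω * t * Complex.I) *
        signalResponse (μ / 2 + ω * Complex.I) (chiParam c₀ γ g μ ^ 2 / 4) (z / c₀) t).re := by
  have hH : z / (2 * scaleHeight c₀ γ g) = muCrit c₀ γ g / 2 * (z / c₀) := by
    unfold muCrit scaleHeight
    field_simp
  rw [re_cexp_mul_signalResponse _ _ _ (by positivity) h.le, shockSol, heavisideStep,
    if_pos (by linarith), hH, ← muCrit,
    show -((μ - muCrit c₀ γ g) / 2) * (z / c₀)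
      = muCrit c₀ γ g / 2 * (z / c₀) + -(μ / 2 * (z / c₀)) by ring, Real.exp_add]
  ring

/-- Identifies q = (σ + iϰ)/2 as the root for p = μ/2 + iω: σϰ = 2μω matches the imaginary part, the
relation between ϰ² and σ² the real part. -/
theorem complex_radical_sq (hm : 0 < muCrit c₀ γ g) (hμ : muCrit c₀ γ g < μ) (hω : 0 < ω) :
    (((sigmaRad (muCrit c₀ γ g) μ ω : ℂ) + kappaRad (muCrit c₀ γ g) μ ω * Complex.I) / 2) ^ 2
      = (μ / 2 + ω * Complex.I) ^ 2 - (chiParam c₀ γ g μ : ℂ) ^ 2 := by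
  have h1 := chiParam_sq hm hμ
  have h2 := kappaRad_sq_eq (m := muCrit c₀ γ g) (hm.trans hμ) hω
  have h3 := sigmaRad_mul_kappaRad (m := muCrit c₀ γ g) (hm.trans hμ) hω
  apply_fun ((↑) : ℝ → ℂ) at h1 h2 h3
  push_cast at h1 h2 h3
  linear_combination h1 - h2 / 4 + h3 * Complex.I / 2 +
    ((kappaRad (muCrit c₀ γ g) μ ω : ℂ) ^ 2 / 4 - ω ^ 2) * Complex.I_sq

theorem largeTimeWave_eq (z t : ℝ) :
    largeTimeWave c₀ γ g μ W₀ ω z t = W₀ * Real.exp (muCrit c₀ γ g / 2 * (z / c₀)) *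
      (Complex.exp (ω * t * Complex.I) *
        Complex.exp (-(((sigmaRad (muCrit c₀ γ g) μ ω : ℂ)
          + kappaRad (muCrit c₀ γ g) μ ω * Complex.I) / 2) * ((z / c₀ : ℝ) : ℂ))).re := by
  set a := z / c₀ with ha
  rw [← Complex.exp_add, Complex.exp_re]
  have hre : ((ω : ℂ) * t * Complex.I + -(((sigmaRad (muCrit c₀ γ g) μ ω : ℂ)
      + kappaRad (muCrit c₀ γ g) μ ω * Complex.I) / 2) * (a : ℂ)).re
      = -(sigmaRad (muCrit c₀ γ g) μ ω / 2 * a) := by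
    simp
  have him : ((ω : ℂ) * t * Complex.I + -(((sigmaRad (muCrit c₀ γ g) μ ω : ℂ)
      + kappaRad (muCrit c₀ γ g) μ ω * Complex.I) / 2) * (a : ℂ)).im
      = ω * t - (1 / 2) * (kappaRad (muCrit c₀ γ g) μ ω / c₀) * z := by
    simp [ha]
    ring
  rw [hre, him, largeTimeWave, ← ha,
    show -((sigmaRad (muCrit c₀ γ g) μ ω - muCrit c₀ γ g) / 2) * a = muCrit c₀ γ g / 2 * a
      + -(sigmaRad (muCrit c₀ γ g) μ ω / 2 * a) by ring, Real.exp_add]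
  ring

theorem tendsto_shockSol_sub_largeTimeWave (hc : 0 < c₀) (hγ : 0 < γ) (hg : 0 < g)
    (hμ : muCrit c₀ γ g < μ) (hω : 0 < ω) {z : ℝ} (hz : 0 ≤ z) :
    Tendsto (fun t => shockSol c₀ γ g μ W₀ ω z t - largeTimeWave c₀ γ g μ W₀ ω z t)
      atTop (𝓝 0) := by
  have hm := muCrit_pos hc hγ hg
  set q : ℂ := ((sigmaRad (muCrit c₀ γ g) μ ω : ℂ)
    + kappaRad (muCrit c₀ γ g) μ ω * Complex.I) / 2 with hq
  have hqre : 0 < q.re := by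
    have := (sigmaRad_mem_Ioo hm hμ hω).1
    simp [hq]
    linarith
  have hlim := tendsto_signalResponse (p := μ / 2 + ω * Complex.I) (q := q)
    (a := z / c₀) (by positivity) (chiParam_nonneg c₀ γ g μ) (by simpa using chiParam_lt hm hμ)
    hqre (complex_radical_sq hm hμ hω)
  have h0 := ((tendsto_iff_norm_sub_tendsto_zero.1 hlim).const_mul
    |W₀ * Real.exp (muCrit c₀ γ g / 2 * (z / c₀))|)
  rw [mul_zero] at h0
  refine squeeze_zero_norm' ?_ h0
  filter_upwards [eventually_gt_atTop (z / c₀)] with t ht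
  rw [shockSol_of_lt hc hγ hg hz ht, largeTimeWave_eq, ← hq, ← mul_sub, ← Complex.sub_re,
    ← mul_sub, Real.norm_eq_abs, abs_mul]
  gcongr
  refine (Complex.abs_re_le_norm _).trans ?_
  rw [norm_mul, ← Complex.ofReal_mul, Complex.norm_exp_ofReal_mul_I, one_mul]

theorem abs_largeTimeWave_le (z t : ℝ) :
    |largeTimeWave c₀ γ g μ W₀ ω z t| ≤
      |W₀| * Real.exp (-((sigmaRad (muCrit c₀ γ g) μ ω - muCrit c₀ γ g) / 2) * (z / c₀)) := by
  rw [largeTimeWave, abs_mul, abs_mul, Real.abs_exp]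
  exact mul_le_of_le_one_right (by positivity) (Real.abs_cos_le_one _)

theorem tendsto_exp_neg_mul_div {b : ℝ} (hb : 0 < b) (hc : 0 < c₀) :
    Tendsto (fun z => Real.exp (-b * (z / c₀))) atTop (𝓝 0) := by
  have h : Tendsto (fun z => b * (z / c₀)) atTop atTop :=
    (tendsto_id.atTop_div_const hc).const_mul_atTop hb
  exact (Real.tendsto_exp_neg_atTop_nhds_zero.comp h).congr fun z => by simp

theorem tendstoUniformly_largeTimeWave (hc : 0 < c₀) (hγ : 0 < γ) (hg : 0 < g)
    (hμ : muCrit c₀ γ g < μ) (hω : 0 < ω) :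
    TendstoUniformly (fun z t => largeTimeWave c₀ γ g μ W₀ ω z t) (fun _ => 0) atTop := by
  have hσ := (sigmaRad_mem_Ioo (muCrit_pos hc hγ hg) hμ hω).1
  have h0 := (tendsto_exp_neg_mul_div
    (b := (sigmaRad (muCrit c₀ γ g) μ ω - muCrit c₀ γ g) / 2) (by linarith) hc).const_mul |W₀|
  rw [mul_zero] at h0
  rw [Metric.tendstoUniformly_iff]
  intro ε hε
  filter_upwards [h0.eventually (gt_mem_nhds hε)] with z hz t
  rw [dist_zero_left, Real.norm_eq_abs]
  exact (abs_largeTimeWave_le z t).trans_lt hz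

/-- Finite speed: for z ≥ c₀t the front has not arrived and the solution is exactly zero. -/
theorem tendsto_shockSol_height (hc : 0 < c₀) (t : ℝ) :
    Tendsto (fun z => shockSol c₀ γ g μ W₀ ω z t) atTop (𝓝 0) := by
  refine tendsto_const_nhds.congr' ?_
  filter_upwards [eventually_ge_atTop (t * c₀)] with z hz
  exact (shockSol_of_le ((le_div_iff₀ hc).2 hz)).symm

theorem eventually_abs_shockSol_lt (hc : 0 < c₀) (hγ : 0 < γ) (hg : 0 < g)
    (hμ : muCrit c₀ γ g < μ) (hω : 0 < ω) {ε : ℝ} (hε : 0 < ε) :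
    ∀ᶠ z in atTop, ∀ᶠ t in atTop, |shockSol c₀ γ g μ W₀ ω z t| < ε := by
  have h := Metric.tendstoUniformly_iff.1
    (tendstoUniformly_largeTimeWave (W₀ := W₀) hc hγ hg hμ hω) (ε / 2) (by positivity)
  filter_upwards [h, eventually_ge_atTop 0] with z hz hz0
  filter_upwards [Metric.tendsto_nhds.1 (tendsto_shockSol_sub_largeTimeWave (W₀ := W₀)
    hc hγ hg hμ hω hz0) (ε / 2) (by positivity)] with t ht
  have hzt := hz t
  rw [dist_zero_left, Real.norm_eq_abs] at hzt
  rw [dist_zero_right, Real.norm_eq_abs] at ht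
  have := abs_add_le (shockSol c₀ γ g μ W₀ ω z t - largeTimeWave c₀ γ g μ W₀ ω z t)
    (largeTimeWave c₀ γ g μ W₀ ω z t)
  rw [sub_add_cancel] at this
  linarith

theorem exp_mul_shockSol_eq (hc : 0 < c₀) (hγ : 0 < γ) (hg : 0 < g) {s z t : ℝ} (hz : 0 ≤ z)
    (ht : z / c₀ < t) :
    Real.exp (-(s * t)) * shockSol c₀ γ g μ W₀ ω z t =
      W₀ * Real.exp (muCrit c₀ γ g / 2 * (z / c₀)) *
        (Complex.exp (-(s - ω * Complex.I) * t) *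
          signalResponse (μ / 2 + ω * Complex.I) (chiParam c₀ γ g μ ^ 2 / 4) (z / c₀) t).re := by
  rw [shockSol_of_lt hc hγ hg hz ht,
    show -((s : ℂ) - ω * Complex.I) * t = ((-(s * t) : ℝ) : ℂ) + ω * t * Complex.I by
      push_cast; ring,
    Complex.exp_add, ← Complex.ofReal_exp, mul_assoc (Real.exp (-(s * t)) : ℂ),
    Complex.re_ofReal_mul]
  ring

theorem integrableOn_exp_mul_shockSol (hc : 0 < c₀) (hγ : 0 < γ) (hg : 0 < g)
    (hμ : muCrit c₀ γ g < μ) {s z : ℝ} (hs : 0 < s) (hz : 0 ≤ z) :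
    IntegrableOn (fun t => Real.exp (-(s * t)) * shockSol c₀ γ g μ W₀ ω z t) (Ioi 0) := by
  have hm := muCrit_pos hc hγ hg
  have ha : 0 ≤ z / c₀ := by positivity
  have hi := integrableOn_cexp_mul_signalResponse (p := μ / 2 + ω * Complex.I)
    (l := s - ω * Complex.I) (by simpa using hs) ha (chiParam_nonneg c₀ γ g μ)
    (by simpa using chiParam_lt hm hμ)
  have h1 : IntegrableOn (fun t => Real.exp (-(s * t)) * shockSol c₀ γ g μ W₀ ω z t)
      (Ioi (z / c₀)) :=
    IntegrableOn.congr_fun (hi.re.const_mul (W₀ * Real.exp (muCrit c₀ γ g / 2 * (z / c₀))))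
      (fun t ht => (exp_mul_shockSol_eq hc hγ hg hz ht).symm) measurableSet_Ioi
  refine h1.of_forall_sdiff_eq_zero measurableSet_Ioi fun t ht => ?_
  rw [shockSol_of_le (not_lt.1 ht.2), mul_zero]

theorem laplaceT_shockSol (hc : 0 < c₀) (hγ : 0 < γ) (hg : 0 < g)
    (hμ : muCrit c₀ γ g < μ) {s z : ℝ} (hs : 0 < s) (hz : 0 ≤ z) :
    laplaceT (shockSol c₀ γ g μ W₀ ω) z s = W₀ * s / (s ^ 2 + ω ^ 2) *
      Real.exp (-(√(s ^ 2 + μ * s + muCrit c₀ γ g ^ 2 / 4) - muCrit c₀ γ g / 2) * (z / c₀)) := by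
  have hm := muCrit_pos hc hγ hg
  have hμ0 : 0 < μ := hm.trans hμ
  have ha : 0 ≤ z / c₀ := by positivity
  set Q := √(s ^ 2 + μ * s + muCrit c₀ γ g ^ 2 / 4) with hQ
  have hQ0 : 0 < Q := Real.sqrt_pos.2 (by positivity)
  have hQ2 : Q ^ 2 = s ^ 2 + μ * s + muCrit c₀ γ g ^ 2 / 4 := Real.sq_sqrt (by positivity)
  have hl : 0 < ((s : ℂ) - ω * Complex.I).re := by simpa using hs
  have hp : chiParam c₀ γ g μ < ((μ : ℂ) / 2 + ω * Complex.I).re := by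
    simpa using chiParam_lt hm hμ
  have hχ := chiParam_sq hm hμ
  -- Here l + p = s + μ/2: the iω cancels, so the root Q is real.
  have hint := integral_cexp_mul_signalResponse (p := μ / 2 + ω * Complex.I)
    (l := s - ω * Complex.I) (q := Q) hl ha (chiParam_nonneg c₀ γ g μ) hp (by simpa using hQ0)
    (by
      apply_fun ((↑) : ℝ → ℂ) at hQ2 hχ
      push_cast at hQ2 hχ
      linear_combination hQ2 + hχ)
  have hi := integrableOn_cexp_mul_signalResponse hl ha (chiParam_nonneg c₀ γ g μ) hp
  rw [laplaceT, setIntegral_eq_of_subset_of_forall_sdiff_eq_zero measurableSet_Ioi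
    (Ioi_subset_Ioi ha) fun t ht => by rw [shockSol_of_le (not_lt.1 ht.2), mul_zero],
    setIntegral_congr_fun measurableSet_Ioi
      (fun t ht => exp_mul_shockSol_eq hc hγ hg hz ht), integral_const_mul]
  have hre := integral_re hi
  simp only [RCLike.re_to_complex] at hre
  rw [hre, hint]
  have hsω : s ^ 2 + ω ^ 2 ≠ 0 := by positivity
  have hdiv : (Complex.exp (-(Q : ℂ) * ((z / c₀ : ℝ) : ℂ)) / (s - ω * Complex.I)).re
      = Real.exp (-Q * (z / c₀)) * (s / (s ^ 2 + ω ^ 2)) := by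
    rw [← Complex.ofReal_neg, ← Complex.ofReal_mul, ← Complex.ofReal_exp, div_eq_mul_inv,
      Complex.re_ofReal_mul, Complex.inv_re]
    congr 2
    · simp
    · simp [Complex.normSq_apply]; ring
  rw [hdiv, show -(Q - muCrit c₀ γ g / 2) * (z / c₀)
    = muCrit c₀ γ g / 2 * (z / c₀) + -Q * (z / c₀) by ring, Real.exp_add]
  ring

theorem solvesSignalingLaplace_shockSol (hc : 0 < c₀) (hγ : 0 < γ) (hg : 0 < g)
    (hμ : muCrit c₀ γ g < μ) :
    SolvesSignalingLaplace c₀ γ g μ W₀ ω (shockSol c₀ γ g μ W₀ ω) := by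
  have hm := muCrit_pos hc hγ hg
  have hμ0 : 0 < μ := hm.trans hμ
  set b : ℝ → ℝ := fun s => √(s ^ 2 + μ * s + muCrit c₀ γ g ^ 2 / 4) - muCrit c₀ γ g / 2 with hb
  have hbpos : ∀ s > 0, 0 < b s := fun s hs => by
    refine sub_pos.2 (Real.lt_sqrt_of_sq_lt ?_)
    have : 0 < s ^ 2 + μ * s := by positivity
    linarith
  -- The characteristic equation of the ODE for the exponent -b/c₀, using γg = c₀μ_c.
  have hbsq : ∀ s > 0, b s ^ 2 + muCrit c₀ γ g * b s = s ^ 2 + μ * s := fun s hs => by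
    have := Real.sq_sqrt (by positivity : 0 ≤ s ^ 2 + μ * s + muCrit c₀ γ g ^ 2 / 4)
    simp only [hb]
    linear_combination this
  set u : ℝ → ℝ → ℝ := fun s z => W₀ * s / (s ^ 2 + ω ^ 2) * Real.exp (-b s * (z / c₀)) with hu
  have hL : ∀ s > 0, ∀ z ≥ 0, laplaceT (shockSol c₀ γ g μ W₀ ω) z s = u s z :=
    fun s hs z hz => laplaceT_shockSol hc hγ hg hμ hs hz
  have hu' : ∀ s z, HasDerivAt (u s) (-b s / c₀ * u s z) z := fun s z => by
    have h := ((((hasDerivAt_id z).div_const c₀).const_mul (-b s)).exp).const_mul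
      (W₀ * s / (s ^ 2 + ω ^ 2))
    refine h.congr_deriv ?_
    simp only [hu, id]
    ring
  have hd1 : ∀ s > 0, ∀ z > 0,
      deriv (fun y => laplaceT (shockSol c₀ γ g μ W₀ ω) y s) z = -b s / c₀ * u s z :=
    fun s hs z hz => by
      refine ((hu' s z).congr_of_eventuallyEq ?_).deriv
      filter_upwards [lt_mem_nhds hz] with y hy
      exact hL s hs y hy.le
  have hd2 : ∀ s > 0, ∀ z > 0,
      deriv (deriv (fun y => laplaceT (shockSol c₀ γ g μ W₀ ω) y s)) z
        = -b s / c₀ * (-b s / c₀ * u s z) := fun s hs z hz => by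
    refine (((hu' s z).const_mul (-b s / c₀)).congr_of_eventuallyEq ?_).deriv
    filter_upwards [lt_mem_nhds hz] with y hy
    exact hd1 s hs y hy
  have hsmooth : ∀ s, ContDiff ℝ 2 (u s) := fun s => by
    simp only [hu]
    fun_prop
  refine ⟨?_, ?_, ?_, ?_, ?_, ?_⟩
  · exact fun s hs z hz => integrableOn_exp_mul_shockSol hc hγ hg hμ hs hz
  · exact fun s hs => (hsmooth s).contDiffOn.congr fun z hz => hL s hs z (le_of_lt hz)
  · exact fun s hs => (hsmooth s).continuous.continuousOn.congr fun z hz => hL s hs z hz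
  · intro s hs z hz
    rw [hd1 s hs z hz, hd2 s hs z hz, hL s hs z hz.le, ← mul_muCrit hc hγ hg, ← hbsq s hs]
    field_simp
    ring
  · intro s hs
    rw [hL s hs 0 le_rfl]
    simp [hu]
  · intro s hs
    have h := (tendsto_exp_neg_mul_div (hbpos s hs) hc).const_mul (W₀ * s / (s ^ 2 + ω ^ 2))
    rw [mul_zero] at h
    refine h.congr' ?_
    filter_upwards [eventually_ge_atTop 0] with z hz
    exact (hL s hs z hz).symm

theorem largeTimeWave_highFrequency (hω : 0 < ω) (z t : ℝ) :
    largeTimeWave c₀ γ g μ W₀ ω z t =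
      W₀ * Real.exp (-((μ - muCrit c₀ γ g) / 2 + (sigmaRad (muCrit c₀ γ g) μ ω - μ) / 2)
          * (z / c₀)) *
        Real.cos (ω * t - ω * (1 + (μ ^ 2 - muCrit c₀ γ g ^ 2) / (8 * ω ^ 2) +
          (kappaRad (muCrit c₀ γ g) μ ω / (2 * ω) - 1
            - (μ ^ 2 - muCrit c₀ γ g ^ 2) / (8 * ω ^ 2))) * (z / c₀)) := by
  rw [largeTimeWave]
  congr 2
  · congr 1; ring
  · have h : ω * (kappaRad (muCrit c₀ γ g) μ ω / (2 * ω)) = kappaRad (muCrit c₀ γ g) μ ω / 2 := by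
      field_simp
    linear_combination (z / c₀) * h

end Signaling

theorem mainTheorem5 (c₀ γ g μ W₀ : ℝ) (hc : 0 < c₀) (hγ : 0 < γ) (hg : 0 < g) (hW : 0 < W₀)
    (hμ : muCrit c₀ γ g < μ) :
    -- the time-domain formula is the Laplace-domain solution of the signaling problem
    (∀ ω > 0, SolvesSignalingLaplace c₀ γ g μ W₀ ω (shockSol c₀ γ g μ W₀ ω)) ∧
    -- large-time behavior at every fixed height
    (∀ ω > 0, ∀ z ≥ 0, Tendsto
      (fun t => shockSol c₀ γ g μ W₀ ω z t - largeTimeWave c₀ γ g μ W₀ ω z t) atTop (𝓝 0)) ∧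
    -- range of the attenuation radical
    (∀ ω > 0, sigmaRad (muCrit c₀ γ g) μ ω ∈ Ioo (muCrit c₀ γ g) μ) ∧
    -- decay in height: of the waveform uniformly in time, of the exact solution at large times,
    -- and of the exact solution at each fixed time
    (∀ ω > 0, TendstoUniformly (fun z t => largeTimeWave c₀ γ g μ W₀ ω z t)
      (fun _ => 0) atTop) ∧
    (∀ ω > 0, ∀ ε > 0, ∀ᶠ z in atTop, ∀ᶠ t in atTop, |shockSol c₀ γ g μ W₀ ω z t| < ε) ∧
    (∀ ω > 0, ∀ t, Tendsto (fun z => shockSol c₀ γ g μ W₀ ω z t) atTop (𝓝 0)) ∧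
    -- high-frequency form of the waveform
    (∃ e₁ e₂ : ℝ → ℝ,
      (e₁ =O[atTop] fun ω => 1 / ω ^ 2) ∧ (e₂ =O[atTop] fun ω => 1 / ω ^ 4) ∧
      ∀ ω > 0, ∀ z ≥ 0,
        (∀ t, largeTimeWave c₀ γ g μ W₀ ω z t =
          W₀ * Real.exp (-((μ - muCrit c₀ γ g) / 2 + e₁ ω) * (z / c₀)) *
            Real.cos (ω * t
              - ω * (1 + (μ ^ 2 - muCrit c₀ γ g ^ 2) / (8 * ω ^ 2) + e₂ ω) * (z / c₀))) ∧
        Tendsto (fun t => shockSol c₀ γ g μ W₀ ω z t -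
          W₀ * Real.exp (-((μ - muCrit c₀ γ g) / 2 + e₁ ω) * (z / c₀)) *
            Real.cos (ω * t
              - ω * (1 + (μ ^ 2 - muCrit c₀ γ g ^ 2) / (8 * ω ^ 2) + e₂ ω) * (z / c₀)))
          atTop (𝓝 0)) ∧
    -- high-frequency expansion of the phase velocity
    ((fun ω => phaseVelocity c₀ γ g μ ω
        - c₀ * (1 - (μ ^ 2 - muCrit c₀ γ g ^ 2) / (8 * ω ^ 2)))
      =O[atTop] fun ω => 1 / ω ^ 4) := by
  have hm := muCrit_pos hc hγ hg
  refine ⟨fun ω _ => solvesSignalingLaplace_shockSol hc hγ hg hμ,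
    fun ω hω z hz => tendsto_shockSol_sub_largeTimeWave hc hγ hg hμ hω hz,
    fun ω hω => sigmaRad_mem_Ioo hm hμ hω,
    fun ω hω => tendstoUniformly_largeTimeWave hc hγ hg hμ hω,
    fun ω hω ε hε => eventually_abs_shockSol_lt hc hγ hg hμ hω hε,
    fun ω _ t => tendsto_shockSol_height hc t,
    -- The witnesses are the exact remainders (σ - μ)/2 and ϰ/(2ω) - 1 - (μ² - μ_c²)/(8ω²), so the
    -- high-frequency form is an identity.
    ⟨_, _, sigmaRad_sub_isBigO hm hμ, kappaRad_sub_isBigO hm hμ, fun ω hω z hz =>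
      ⟨fun t => largeTimeWave_highFrequency hω z t, ?_⟩⟩, ?_⟩
  · refine (tendsto_shockSol_sub_largeTimeWave (W₀ := W₀) hc hγ hg hμ hω hz).congr fun t => ?_
    rw [← largeTimeWave_highFrequency hω z t]
  · refine ((inv_kappaRad_isBigO hm hμ).const_mul_left c₀).congr_left fun ω => ?_
    rw [phaseVelocity, mul_sub, inv_div, div_div_eq_mul_div]
    ring
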